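/- Let $T$ be an open quipu on $n\ge 6$ vertices, that is, a finite tree of maximum degree at most $3$ all of whose vertices of degree $3$ lie on one path. Let $\rho(T)$ be the largest eigenvalue of the adjacency matrix of $T$ and $D(T)$ its diameter. If $\rho(T)<\frac32\sqrt2$, then $$D(T)\ \ge\ \frac{2n-4}{3}.$$ For an integer $m\ge 2$ let $P_{(1,m-2,m)}^{(1,m)}$ be the tree on $3m+2$ vertices that has exactly two vertices $u,v$ of degree $3$, joined by a path with $m-2$ internal vertices, where two further paths, both with $1$ vertex, hang from $u$, and two further paths, both with $m$ vertices, hang from $v$. A graph $T$ on $n\ge 6$ vertices is an open quipu with $\rho(T)<\frac32\sqrt2$ and $D(T)=\frac{2n-4}{3}$ if and only if $T$ is isomorphic to $P_{(1,m-2,m)}^{(1,m)}$ for some integer $m\ge 2$. -/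

import Mathlib

/-- The spectral radius of a finite graph: the largest eigenvalue of its adjacency matrix. -/
noncomputable def graphSpectralRadius {V : Type*} [Fintype V] [DecidableEq V]
    (G : SimpleGraph V) [DecidableRel G.Adj] : ℝ :=
  sSup {x : ℝ | Module.End.HasEigenvalue (Matrix.toLin' (G.adjMatrix ℝ)) x}

/-- An open quipu: a tree of maximum degree at most `3`, all of whose vertices of degree `3`
lie on one path. -/
def IsOpenQuipu {V : Type*} [Fintype V] (G : SimpleGraph V) [DecidableRel G.Adj] : Prop :=
  G.IsTree ∧ (∀ v, G.degree v ≤ 3) ∧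
    ∃ (u v : V) (p : G.Walk u v), p.IsPath ∧ ∀ w, G.degree w = 3 → w ∈ p.support

/-- The position on the main path of the `i`-th branching vertex: it is preceded by the first
`i + 1` blocks of `k 0, …, k i` vertices and by `i` earlier branching vertices. -/
def quipuBranchPos {r : ℕ} (k : Fin (r + 2) → ℕ) (i : Fin (r + 1)) : ℕ :=
  (∑ j : Fin (r + 2), if j.val ≤ i.val then k j else 0) + i.val

/-- Vertices of `openQuipu k m`: the main path, which has `k 0 + ⋯ + k (r + 1)` vertices besides
the `r + 1` branching vertices, and the `m i` vertices of the path hanging from the `i`-th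
branching vertex. -/
abbrev QuipuVertex {r : ℕ} (k : Fin (r + 2) → ℕ) (m : Fin (r + 1) → ℕ) : Type :=
  Fin ((∑ j, k j) + (r + 1)) ⊕ (Σ i : Fin (r + 1), Fin (m i))

/-- One orientation of the edges of `openQuipu k m`: consecutive vertices on the main path,
the `i`-th branching vertex and the first vertex of the path hanging from it, and consecutive
vertices on the same hanging path. -/
def quipuRel {r : ℕ} (k : Fin (r + 2) → ℕ) (m : Fin (r + 1) → ℕ) :
    QuipuVertex k m → QuipuVertex k m → Prop
  | Sum.inl a, Sum.inl b => a.val + 1 = b.val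
  | Sum.inl a, Sum.inr ⟨i, s⟩ => a.val = quipuBranchPos k i ∧ s.val = 0
  | Sum.inr ⟨i, s⟩, Sum.inr ⟨j, t⟩ => i = j ∧ s.val + 1 = t.val
  | Sum.inr _, Sum.inl _ => False

/-- The open quipu `P_{(k 0, k 1, …, k (r + 1))}^{(m 0, …, m r)}`. When `k 0`, `k (r + 1)` and
all `m i` are positive, it has `r` internal paths with
`k 1, …, k r` internal vertices and `r + 3` pendent paths of lengths
`k 0, m 0, m 1, …, m r, k (r + 1)`. -/
def openQuipu {r : ℕ} (k : Fin (r + 2) → ℕ) (m : Fin (r + 1) → ℕ) :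
    SimpleGraph (QuipuVertex k m) :=
  SimpleGraph.fromRel (quipuRel k m)

/-! The number `3/2 * √2` equals `t + 1/t` with `t = √2`. If the spectral radius is smaller, then `c
- A` is positive definite for `c = t + 1/t`, and an M-matrix argument gives a positive `y` with `A y
< c y`. Write `Z j = t^j * y j` along the main path. Eliminating each hanging path turns the
inequality at vertex `j + 1` into one involving only `Z j`, `Z (j + 1)`, `Z (j + 2)` and `2 ^ h (j +
1)`. Where nothing hangs it reads `2 Z j + Z (j+2) < 3 Z (j+1)`, and the equality case has the
solutions `α + β * 2^j`. The coefficients are read off as `α = 2 Z j - Z (j+1)` and `β * 2^j = Z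
(j+1) - Z j`.

The ratio `(Z (j+1) - Z j) / (2 Z j - Z (j+1))` at most doubles per step along a gap between
branching vertices. It is bounded above just after a branching vertex and below just before the next
one, by explicit functions of the hanging lengths. So a gap of `k` vertices between hanging lengths
`p` and `q` forces `p + q ≤ k`, relaxed to `k + 2` if one of the two is outermost and to `k + 3` if
both are (`gap_middle`, `gap_first`, `gap_first_last`).

The main path is chosen longest among the paths through all vertices of degree 3, so an outermost
hanging path is no longer than the end of the main path beyond its branching vertex. With `L` main
vertices and total hanging length `S`, summing all bounds gives `2 S ≤ L + 1` (`two_mul_sum_le`).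
Since `n = L + S` and the diameter is at least `L - 1`, the inequality follows. Equality excludes a
third branching vertex and forces one hanging length to be 1, which determines the tree. Conversely,
an explicit weight satisfies `A y ≤ c y` on that tree, strictly at one vertex, so its spectral
radius is below `c`. -/

/-! ### Inequalities along the main path -/

/-- A positive sequence `Z` on the main path of a quipu whose `j`-th vertex (`1 ≤ j ≤ L`) carries a
hanging path of `h j` vertices, satisfying the inequalities forced by a spectral radius
below `3 / √2`, together with the length bounds at the two outermost branching vertices. -/
structure QuipuProfile (L : ℕ) (h : ℕ → ℕ) (Z : ℕ → ℝ) : Prop where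
  supp : ∀ j, h j ≠ 0 → 1 ≤ j ∧ j ≤ L
  zero : Z 0 = 0
  last : Z (L + 1) = 0
  pos : ∀ j, 1 ≤ j → j ≤ L → 0 < Z j
  ineq : ∀ j, j < L → (2 * 2 ^ h (j + 1) - 1) * (2 * Z j + Z (j + 2)) <
    (4 * 2 ^ h (j + 1) - 1) * Z (j + 1)
  first_le : ∀ a, h a ≠ 0 → (∀ i, i < a → h i = 0) → h a + 1 ≤ a
  last_le : ∀ b, h b ≠ 0 → (∀ i, b < i → h i = 0) → h b + b ≤ L

namespace QuipuProfile

theorem one_le_two_pow (n : ℕ) : (1 : ℝ) ≤ 2 ^ n := one_le_pow₀ (by norm_num)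

theorem two_le_two_pow {n : ℕ} (hn : n ≠ 0) : (2 : ℝ) ≤ 2 ^ n := by
  obtain ⟨k, rfl⟩ := Nat.exists_eq_succ_of_ne_zero hn
  have := one_le_two_pow k
  rw [pow_succ]; linarith

/-- The equality case with `U 0 = 0` is `U j = 2^j - 1`; a supersolution grows no faster. -/
theorem prefix_le {U : ℕ → ℝ} (h0 : U 0 = 0) (j : ℕ)
    (hU : ∀ i, i < j → 2 * U i + U (i + 2) < 3 * U (i + 1)) :
    (2 ^ j - 1) * U (j + 1) ≤ (2 * 2 ^ j - 1) * U j := by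
  induction j with
  | zero => simp [h0]
  | succ j ih =>
    have h1 := ih (fun i hi => hU i (by omega))
    have h2 := hU j (by omega)
    have h3 := one_le_two_pow j
    have h4 : (2 * 2 ^ j - 1) * (2 * U j + U (j + 2)) ≤ (2 * 2 ^ j - 1) * (3 * U (j + 1)) :=
      mul_le_mul_of_nonneg_left h2.le (by linarith)
    rw [pow_succ]
    nlinarith

variable {L : ℕ} {h : ℕ → ℕ} {Z : ℕ → ℝ}

/-- Since `Z j` is `t^j` times a vertex value with `t^2 = 2`, reading the path backwards costs the
factor `2^j`. The coefficients of `1` and `2^j` change places, so each bound on the left yields one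
on the right. -/
theorem reverse (P : QuipuProfile L h Z) :
    QuipuProfile L (fun j => h (L + 1 - j)) (fun j => 2 ^ j * Z (L + 1 - j)) where
  supp j hj := by
    have := P.supp _ hj
    omega
  zero := by simp [P.last]
  last := by simp [P.zero]
  pos j h1 h2 := by
    have := P.pos (L + 1 - j) (by omega) (by omega)
    positivity
  ineq j hj := by
    have := P.ineq (L - 1 - j) (by omega)
    rw [show L - 1 - j + 1 = L + 1 - (j + 1) by omega, show L - 1 - j + 2 = L + 1 - j by omega,
      show L - 1 - j = L + 1 - (j + 2) by omega] at this
    have h2 : (0 : ℝ) < 2 ^ (j + 1) := by positivity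
    have := mul_lt_mul_of_pos_left this h2
    simp only [pow_succ] at this ⊢
    linarith
  first_le a ha hi := by
    have h1 := P.supp _ ha
    have := P.last_le (L + 1 - a) ha (fun i hi' => by
      by_contra hc
      have h2 := P.supp _ hc
      have h3 := hi (L + 1 - i) (by omega)
      rw [show L + 1 - (L + 1 - i) = i by omega] at h3
      exact hc h3)
    omega
  last_le a ha hi := by
    have h1 := P.supp _ ha
    have := P.first_le (L + 1 - a) ha (fun i hi' => by
      by_contra hc
      have h2 := P.supp _ hc
      have h3 := hi (L + 1 - i) (by omega)
      rw [show L + 1 - (L + 1 - i) = i by omega] at h3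
      exact hc h3)
    omega

theorem first_branch_left (P : QuipuProfile L h Z) {a : ℕ} (ha : h a ≠ 0)
    (hz : ∀ i, i < a → h i = 0) :
    0 < 2 * Z a - Z (a + 1) ∧
      (2 * 2 ^ h a - 3) / 2 * (Z (a + 1) - Z a) < 2 * Z a - Z (a + 1) := by
  have h0 := P.supp a ha
  have h1 := P.first_le a ha hz
  obtain ⟨j, rfl⟩ : ∃ j, a = j + 1 := ⟨a - 1, by omega⟩
  have h2 := prefix_le P.zero j (fun i hi => by
    have := P.ineq i (by omega)
    rw [hz (i + 1) (by omega)] at this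
    norm_num at this
    exact this)
  have h3 := P.ineq j (by omega)
  have hp := P.pos (j + 1) (by omega) (by omega)
  have hA := two_le_two_pow ha
  have hAJ : (2 : ℝ) ^ h (j + 1) ≤ 2 ^ j := pow_le_pow_right₀ (by norm_num) (by omega)
  set A : ℝ := 2 ^ h (j + 1)
  set J : ℝ := 2 ^ j
  -- `(J - 1) / (2J - 1)` increases with `J`, so the prefix bound survives replacing `J` by the
  -- smaller `A`.
  have hx : (A - 1) * Z (j + 1) ≤ (2 * A - 1) * Z j := by
    have h5 : (2 * J - 1) * ((A - 1) * Z (j + 1)) ≤ (2 * J - 1) * ((2 * A - 1) * Z j) := by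
      have h6 := mul_le_mul_of_nonneg_left h2 (show 0 ≤ 2 * A - 1 by linarith)
      nlinarith [mul_nonneg (sub_nonneg.2 hAJ) hp.le]
    exact le_of_mul_le_mul_left h5 (by linarith)
  have hd : (2 * A - 1) * Z (j + 2) < (2 * A + 1) * Z (j + 1) := by nlinarith
  have e : j + 1 + 1 = j + 2 := rfl
  rw [e]
  constructor
  · by_contra hc
    nlinarith
  · by_contra hc
    nlinarith

theorem left_pos (P : QuipuProfile L h Z) {a : ℕ} (ha : h a ≠ 0) {j : ℕ} (haj : a ≤ j)
    (hj : j ≤ L) : 0 < 2 * Z j - Z (j + 1) := by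
  have hex : ∃ a, h a ≠ 0 := ⟨a, ha⟩
  classical
  set a₀ := Nat.find hex
  have h1 : h a₀ ≠ 0 := Nat.find_spec hex
  have h2 : ∀ i, i < a₀ → h i = 0 := fun i hi => by simpa using Nat.find_min hex hi
  have h3 : a₀ ≤ j := (Nat.find_min' hex ha).trans haj
  clear_value a₀
  induction j, h3 using Nat.le_induction generalizing a with
  | base => exact (P.first_branch_left h1 h2).1
  | succ j hj' ih =>
    have h4 := ih h1 hj' (by omega)
    have h5 := P.ineq j (by omega)
    have h6 := P.pos (j + 1) (by omega) hj
    have h7 := one_le_two_pow (h (j + 1))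
    have e : j + 1 + 1 = j + 2 := rfl
    rw [e]
    by_contra hc
    nlinarith

/-- After an earlier branching vertex only `Z q < 2 Z (q - 1)` is known, in place of the sharper
prefix bound available at the first one; hence the constant `2A - 2`. -/
theorem middle_left (P : QuipuProfile L h Z) {a q : ℕ} (ha : h a ≠ 0) (haq : a < q)
    (hq : h q ≠ 0) :
    (2 * 2 ^ h q - 2) * (Z (q + 1) - Z q) < 2 * Z q - Z (q + 1) := by
  have h0 := P.supp q hq
  obtain ⟨j, rfl⟩ : ∃ j, q = j + 1 := ⟨q - 1, by omega⟩
  have h1 := P.left_pos ha (j := j) (by omega) (by omega)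
  have h2 := P.ineq j (by omega)
  have hA := two_le_two_pow hq
  set A : ℝ := 2 ^ h (j + 1)
  have e : j + 1 + 1 = j + 2 := rfl
  rw [e]
  by_contra hc
  nlinarith

/-- On a stretch without hanging paths `2 Z j - Z (j+1)` increases, while `Z (j+1) - Z j` less than
doubles at each step. -/
theorem gap_left (P : QuipuProfile L h Z) {α : ℝ} (hα : 0 ≤ α) {p : ℕ}
    (hp : α * (Z (p + 1) - Z p) < 2 * Z p - Z (p + 1)) (k : ℕ) (hk : p + k ≤ L)
    (hz : ∀ i, p < i → i ≤ p + k → h i = 0) :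
    α * (Z (p + k + 1) - Z (p + k)) < 2 ^ k * (2 * Z (p + k) - Z (p + k + 1)) := by
  induction k with
  | zero => simpa using hp
  | succ k ih =>
    have h1 := ih (by omega) (fun i hi hi' => hz i hi (by omega))
    have h2 := P.ineq (p + k) (by omega)
    rw [show p + k + 1 = p + (k + 1) by omega, hz (p + (k + 1)) (by omega) le_rfl,
      show p + k + 2 = p + (k + 1) + 1 by omega] at h2
    rw [show p + k + 1 = p + (k + 1) by omega] at h1
    norm_num at h2
    have h3 : (0 : ℝ) < 2 ^ k := by positivity
    rw [pow_succ (2 : ℝ) k]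
    have h4 : α * (Z (p + (k + 1) + 1) - Z (p + (k + 1))) ≤
        α * (2 * (Z (p + (k + 1)) - Z (p + k))) := mul_le_mul_of_nonneg_left (by linarith) hα
    have h5 : 2 ^ k * (2 * Z (p + k) - Z (p + (k + 1))) <
        2 ^ k * (2 * Z (p + (k + 1)) - Z (p + (k + 1) + 1)) :=
      mul_lt_mul_of_pos_left (by linarith) h3
    linarith

theorem last_branch_right (P : QuipuProfile L h Z) {b : ℕ} (hb : h (b + 1) ≠ 0)
    (hz : ∀ i, b + 1 < i → h i = 0) :
    (2 * 2 ^ h (b + 1) - 3) / 4 * (2 * Z b - Z (b + 1)) < Z (b + 1) - Z b := by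
  have h0 := P.supp _ hb
  have := (P.reverse.first_branch_left (a := L - b)
    (by simpa [show L + 1 - (L - b) = b + 1 by omega] using hb)
    (fun i hi => hz _ (by omega))).2
  simp only [show L + 1 - (L - b) = b + 1 by omega, show L + 1 - (L - b + 1) = b by omega,
    pow_succ] at this
  have h2 : (0 : ℝ) < 2 ^ (L - b) := by positivity
  refine lt_of_mul_lt_mul_left ?_ h2.le
  linarith

theorem middle_right (P : QuipuProfile L h Z) {b q : ℕ} (hb : h b ≠ 0) (hqb : q + 1 < b)
    (hq : h (q + 1) ≠ 0) :
    (2 ^ h (q + 1) - 1) * (2 * Z q - Z (q + 1)) < Z (q + 1) - Z q := by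
  have h0 := P.supp _ hb
  have := P.reverse.middle_left (a := L + 1 - b) (q := L - q)
    (by simpa [show L + 1 - (L + 1 - b) = b by omega] using hb) (by omega)
    (by simpa [show L + 1 - (L - q) = q + 1 by omega] using hq)
  simp only [show L + 1 - (L - q) = q + 1 by omega, show L + 1 - (L - q + 1) = q by omega,
    pow_succ] at this
  have h2 : (0 : ℝ) < 2 ^ (L - q) := by positivity
  refine lt_of_mul_lt_mul_left ?_ h2.le
  linarith

theorem gap_bound (P : QuipuProfile L h Z) {α β : ℝ} (hα : 0 ≤ α) {p k : ℕ}
    (hp0 : h p ≠ 0) (hp : α * (Z (p + 1) - Z p) < 2 * Z p - Z (p + 1)) (hk : p + k ≤ L)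
    (hz : ∀ i, p < i → i ≤ p + k → h i = 0)
    (hq : β * (2 * Z (p + k) - Z (p + k + 1)) < Z (p + k + 1) - Z (p + k)) :
    α * β < 2 ^ k := by
  have h1 := P.gap_left hα hp k hk hz
  have h2 := P.left_pos hp0 (Nat.le_add_right p k) hk
  refine lt_of_mul_lt_mul_right ?_ h2.le
  have := mul_le_mul_of_nonneg_left hq.le hα
  linarith

theorem two_pow_mul_le {k m m' e : ℕ} (hk : k + e ≤ m + m') :
    (2 : ℝ) ^ k * 2 ^ e ≤ 2 ^ m * 2 ^ m' := by
  rw [← pow_add, ← pow_add]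
  exact pow_le_pow_right₀ (by norm_num) hk

theorem gap_middle (P : QuipuProfile L h Z) {a b p k : ℕ} (ha : h a ≠ 0) (hap : a < p)
    (hp : h p ≠ 0) (hz : ∀ i, p < i → i ≤ p + k → h i = 0) (hq : h (p + k + 1) ≠ 0)
    (hb : h b ≠ 0) (hqb : p + k + 1 < b) : h p + h (p + k + 1) ≤ k := by
  have hL := P.supp _ hq
  have hA := two_le_two_pow hp
  have hB := two_le_two_pow hq
  have := P.gap_bound (by linarith) hp (P.middle_left ha hap hp) (by omega) hz
    (P.middle_right hb hqb hq)
  by_contra hc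
  have h2 := two_pow_mul_le (show k + 1 ≤ h p + h (p + k + 1) by omega)
  nlinarith [mul_nonneg (sub_nonneg.2 hA) (sub_nonneg.2 hB)]

theorem gap_first (P : QuipuProfile L h Z) {b p k : ℕ} (hz0 : ∀ i, i < p → h i = 0)
    (hp : h p ≠ 0) (hz : ∀ i, p < i → i ≤ p + k → h i = 0) (hq : h (p + k + 1) ≠ 0)
    (hb : h b ≠ 0) (hqb : p + k + 1 < b) :
    h p + h (p + k + 1) ≤ k + 2 ∧ (h p + h (p + k + 1) = k + 2 → h p = 1) := by
  have hL := P.supp _ hq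
  have hA := two_le_two_pow hp
  have hB := two_le_two_pow hq
  have := P.gap_bound (by linarith) hp (P.first_branch_left hp hz0).2 (by omega) hz
    (P.middle_right hb hqb hq)
  constructor
  · by_contra hc
    have h2 := two_pow_mul_le (show k + 3 ≤ h p + h (p + k + 1) by omega)
    nlinarith [mul_nonneg (sub_nonneg.2 hA) (sub_nonneg.2 hB)]
  · intro he
    by_contra hc
    have h2 := two_pow_mul_le he.ge
    have h4 : (4 : ℝ) ≤ 2 ^ h p := by
      have : (2 : ℝ) ^ 2 ≤ 2 ^ h p := pow_le_pow_right₀ (by norm_num) (by omega)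
      linarith
    nlinarith [mul_nonneg (sub_nonneg.2 h4) (sub_nonneg.2 hB)]

/-- With `A`, `B` the powers of 2 at the two ends, the gap bound is `(2A - 3)(2B - 3) < 8 * 2^k`.
The factor `2A - 3` is only `A / 2` at `A = 2`, but exceeds `A` from `A = 4` on; so the extreme
value `k + 3` needs a hanging path of length 1. -/
theorem gap_first_last (P : QuipuProfile L h Z) {p k : ℕ} (hz0 : ∀ i, i < p → h i = 0)
    (hp : h p ≠ 0) (hz : ∀ i, p < i → i ≤ p + k → h i = 0) (hq : h (p + k + 1) ≠ 0)
    (hz1 : ∀ i, p + k + 1 < i → h i = 0) :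
    h p + h (p + k + 1) ≤ k + 3 ∧
      (h p + h (p + k + 1) = k + 3 → h p = 1 ∨ h (p + k + 1) = 1) := by
  have hL := P.supp _ hq
  have hA := two_le_two_pow hp
  have hB := two_le_two_pow hq
  have := P.gap_bound (by linarith) hp (P.first_branch_left hp hz0).2 (by omega) hz
    (P.last_branch_right hq hz1)
  have key : ∀ e, 3 ≤ e → k + e = h p + h (p + k + 1) → h p = 1 ∨ h (p + k + 1) = 1 := by
    intro e he he'
    by_contra! hc
    have h2 := two_pow_mul_le (show k + 3 ≤ h p + h (p + k + 1) by omega)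
    have h4 : (4 : ℝ) ≤ 2 ^ h p := by
      have : (2 : ℝ) ^ 2 ≤ 2 ^ h p := pow_le_pow_right₀ (by norm_num) (by omega)
      linarith
    have h5 : (4 : ℝ) ≤ 2 ^ h (p + k + 1) := by
      have : (2 : ℝ) ^ 2 ≤ 2 ^ h (p + k + 1) := pow_le_pow_right₀ (by norm_num) (by omega)
      linarith
    nlinarith [mul_nonneg (sub_nonneg.2 h4) (sub_nonneg.2 h5)]
  constructor
  · by_contra hc
    have h2 := two_pow_mul_le (show k + 4 ≤ h p + h (p + k + 1) by omega)
    have h3 := one_le_two_pow k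
    nlinarith [mul_nonneg (sub_nonneg.2 hA) (sub_nonneg.2 hB)]
  · exact fun he => key 3 le_rfl he.symm

end QuipuProfile

/-! ### Bounding the total hanging length -/

/-- The lengths of the hanging paths of `P_{(1,m-2,m)}^{(1,m)}` along its main path. -/
def extremalHang (m : ℕ) (j : ℕ) : ℕ := if j = 2 then 1 else if j = m + 1 then m else 0

namespace QuipuProfile

variable {L : ℕ} {h : ℕ → ℕ} {Z : ℕ → ℝ}

theorem sum_range_eq_of_gap {h : ℕ → ℕ} {p k : ℕ} (hz : ∀ i, p < i → i ≤ p + k → h i = 0) :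
    ∑ i ∈ Finset.range (p + k + 1), h i = ∑ i ∈ Finset.range (p + 1), h i := by
  induction k with
  | zero => rfl
  | succ k ih =>
    rw [show p + (k + 1) + 1 = (p + k + 1) + 1 by omega, Finset.sum_range_succ,
      ih (fun i hi hi' => hz i hi (by omega)), hz (p + k + 1) (by omega) (by omega), add_zero]

theorem sum_range_eq_of_zero {h : ℕ → ℕ} {p : ℕ} (hz : ∀ i, i < p → h i = 0) :
    ∑ i ∈ Finset.range p, h i = 0 :=
  Finset.sum_eq_zero (fun i hi => hz i (Finset.mem_range.1 hi))

theorem exists_prev_branch {h : ℕ → ℕ} {a q : ℕ} (ha : h a ≠ 0) (haq : a < q) :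
    ∃ p k, q = p + k + 1 ∧ h p ≠ 0 ∧ ∀ i, p < i → i ≤ p + k → h i = 0 := by
  induction q with
  | zero => omega
  | succ q ih =>
    by_cases hq : h q = 0
    · have : a ≠ q := fun e => ha (e ▸ hq)
      obtain ⟨p, k, rfl, hp, hz⟩ := ih (by omega)
      refine ⟨p, k + 1, rfl, hp, fun i hi hi' => ?_⟩
      rcases Nat.lt_or_ge i (p + k + 1) with h1 | h1
      · exact hz i hi (by omega)
      · rwa [show i = p + k + 1 by omega]
    · exact ⟨q, 0, rfl, hq, fun i hi hi' => by omega⟩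

/-- Induction over the branching vertices. A gap between two middle ones leaves slack, so equality
can occur only when `q` is the second branching vertex and the first carries length 1; the ratio
bound at `q` is kept for `two_mul_sum_lt_of_middle`. -/
theorem middle_sum_le (P : QuipuProfile L h Z) {a b q : ℕ} (ha : h a ≠ 0) (haq : a < q)
    (hq : h q ≠ 0) (hqb : q < b) (hb : h b ≠ 0) :
    2 * ∑ i ∈ Finset.range (q + 1), h i ≤ q + h q ∧
      (2 * ∑ i ∈ Finset.range (q + 1), h i = q + h q →
        Z q - Z (q - 1) < 2 ^ h q * (2 * Z (q - 1) - Z q)) := by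
  induction q using Nat.strong_induction_on generalizing a b with
  | _ q ih =>
    obtain ⟨p, k, rfl, hp, hz⟩ := exists_prev_branch ha haq
    have hL := P.supp _ hq
    rw [Finset.sum_range_succ, sum_range_eq_of_gap hz]
    by_cases hfirst : ∀ i, i < p → h i = 0
    · obtain ⟨h1, h2⟩ := P.gap_first hfirst hp hz hq hb hqb
      have h3 := P.first_le p hp hfirst
      rw [Finset.sum_range_succ, sum_range_eq_of_zero hfirst]
      refine ⟨by omega, fun he => ?_⟩
      have h4 : h p + h (p + k + 1) = k + 2 := by omega
      have h5 := h2 h4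
      have h6 := P.gap_left (by rw [h5]; norm_num) (P.first_branch_left hp hfirst).2 k
        (by omega) hz
      rw [h5] at h6
      rw [show h (p + k + 1) = k + 1 by omega, Nat.add_sub_cancel, pow_succ]
      linarith
    · push Not at hfirst
      obtain ⟨c, hc, hc'⟩ := hfirst
      have h1 := (ih p (by omega) hc' hc hp (show p < p + k + 1 by omega) hq).1
      have h2 := P.gap_middle hc' hc hp hz hq hb hqb
      exact ⟨by omega, fun he => by omega⟩

theorem sum_range_reverse (h : ℕ → ℕ) {L q : ℕ} (hq1 : 1 ≤ q) (hq : q ≤ L) :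
    ∑ i ∈ Finset.range (L + 1 - q + 1), h (L + 1 - i) + ∑ i ∈ Finset.range (q + 1), h i =
      ∑ i ∈ Finset.range (L + 1), h i + h (L + 1) + h q := by
  have h1 : ∑ i ∈ Finset.range (L + 1 - q + 1), h (L + 1 - i) =
      ∑ i ∈ Finset.Ico q (L + 2), h i := by
    have := Finset.sum_Ico_reflect h 0 (m := L + 1 - q + 1) (n := L + 1) (by omega)
    rw [← Finset.range_eq_Ico] at this
    rw [this]
    congr 2
    omega
  have h2 := Finset.sum_range_add_sum_Ico h (show q ≤ L + 2 by omega)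
  rw [h1, Finset.sum_range_succ]
  rw [Finset.sum_range_succ _ (L + 1)] at h2
  omega

/-- The bounds of `middle_sum_le` from both ends add up to `2 S ≤ L + 1`, with `h q` counted twice
on both sides. Equality would make both tight, and the two ratio bounds then contradict the
inequality at `q`. -/
theorem two_mul_sum_lt_of_middle (P : QuipuProfile L h Z) {a b q : ℕ} (ha : h a ≠ 0)
    (haq : a < q) (hq : h q ≠ 0) (hqb : q < b) (hb : h b ≠ 0) :
    2 * ∑ i ∈ Finset.range (L + 1), h i < L + 1 := by
  have hLq := P.supp _ hq
  have hLa := P.supp _ ha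
  have hLb := P.supp _ hb
  obtain ⟨h1, h1'⟩ := P.middle_sum_le ha haq hq hqb hb
  obtain ⟨h2, h2'⟩ := P.reverse.middle_sum_le (a := L + 1 - b) (b := L + 1 - a)
    (q := L + 1 - q) (by simpa [show L + 1 - (L + 1 - b) = b by omega] using hb) (by omega)
    (by simpa [show L + 1 - (L + 1 - q) = q by omega] using hq) (by omega)
    (by simpa [show L + 1 - (L + 1 - a) = a by omega] using ha)
  have hL1 : h (L + 1) = 0 := by
    by_contra hc
    have := P.supp _ hc
    omega
  have h3 := sum_range_reverse h hLq.1 hLq.2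
  simp only [show L + 1 - (L + 1 - q) = q by omega,
    show L + 1 - (L + 1 - q - 1) = q + 1 by omega] at h2 h2'
  by_contra hc
  have e1 := h1' (by omega)
  have e2 := h2' (by omega)
  have hB := two_le_two_pow hq
  obtain ⟨j, rfl⟩ : ∃ j, q = j + 1 := ⟨q - 1, by omega⟩
  have e3 := P.ineq j (by omega)
  have hp := P.pos (j + 1) (by omega) (by omega)
  rw [Nat.add_sub_cancel] at e1
  rw [show j + 1 + 1 = j + 2 from rfl] at e2
  set B : ℝ := 2 ^ h (j + 1)
  have e5 : 2 * Z (j + 1) - Z (j + 2) < 2 * B * (Z (j + 2) - Z (j + 1)) := by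
    have h7 : (0 : ℝ) < 2 ^ (L + 1 - (j + 1) - 1) := by positivity
    rw [show (2 : ℝ) ^ (L + 1 - (j + 1)) = 2 ^ (L + 1 - (j + 1) - 1) * 2 by
      rw [← pow_succ]; congr 1; omega] at e2
    refine lt_of_mul_lt_mul_left ?_ h7.le
    linarith
  -- `e6` and `e7` make `2 Z j + Z (j+2)` exceed `(4B + 4) / (2B + 1) * Z (j+1)`, whereas `e3` keeps
  -- it below `(4B - 1) / (2B - 1) * Z (j+1)`. After cross-multiplication the gap is `2B - 3 > 0`.
  have e6 : (2 * B - 1) * ((2 * B + 2) * Z (j + 1)) < (2 * B - 1) * ((2 * B + 1) * Z (j + 2)) :=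
    mul_lt_mul_of_pos_left (by linarith) (by linarith)
  have e7 : (2 * B - 1) * ((B + 1) * Z (j + 1)) < (2 * B - 1) * ((2 * B + 1) * Z j) :=
    mul_lt_mul_of_pos_left (by linarith) (by linarith)
  have e8 := mul_lt_mul_of_pos_left e3 (show 0 < 2 * B + 1 by linarith)
  nlinarith

/-- The bound on the total length of the hanging paths, with the case of equality. -/
theorem two_mul_sum_le (P : QuipuProfile L h Z) (hL : 1 ≤ L) :
    2 * ∑ i ∈ Finset.range (L + 1), h i ≤ L + 1 ∧
      (2 * ∑ i ∈ Finset.range (L + 1), h i = L + 1 →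
        ∃ m, 2 ≤ m ∧ L = 2 * m + 1 ∧
          (h = extremalHang m ∨ (fun j => h (L + 1 - j)) = extremalHang m)) := by
  classical
  by_cases hex : ∃ a, h a ≠ 0
  swap
  · push Not at hex
    rw [sum_range_eq_of_zero (fun i _ => hex i)]
    omega
  obtain ⟨a, ha, hfirst⟩ : ∃ a, h a ≠ 0 ∧ ∀ i, i < a → h i = 0 :=
    ⟨Nat.find hex, Nat.find_spec hex, fun i hi => by simpa using Nat.find_min hex hi⟩
  have hLa := P.supp _ ha
  have hfa := P.first_le a ha hfirst
  obtain ⟨b, k, hbL, hb, hlast'⟩ := exists_prev_branch ha (show a < L + 1 by omega)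
  have hlast : ∀ i, b < i → h i = 0 := by
    intro i hi
    by_contra hc
    have := P.supp _ hc
    exact hc (hlast' i hi (by omega))
  have hlb := P.last_le b hb hlast
  have hLb := P.supp _ hb
  have hab : a ≤ b := by
    by_contra hc
    exact ha (hlast a (by omega))
  have hsum : ∑ i ∈ Finset.range (L + 1), h i = ∑ i ∈ Finset.range (b + 1), h i := by
    rw [hbL, sum_range_eq_of_gap hlast']
  rcases hab.eq_or_lt with rfl | hab
  · rw [hsum, Finset.sum_range_succ, sum_range_eq_of_zero hfirst]
    omega
  by_cases hmid : ∃ q, a < q ∧ q < b ∧ h q ≠ 0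
  · obtain ⟨q, h1, h2, h3⟩ := hmid
    have := P.two_mul_sum_lt_of_middle ha h1 h3 h2 hb
    omega
  push Not at hmid
  obtain ⟨l, rfl⟩ : ∃ l, b = a + l + 1 := ⟨b - a - 1, by omega⟩
  have hz : ∀ i, a < i → i ≤ a + l → h i = 0 := fun i h1 h2 => hmid i h1 (by omega)
  obtain ⟨g1, g2⟩ := P.gap_first_last hfirst ha hz hb hlast
  rw [hsum, Finset.sum_range_succ, sum_range_eq_of_gap hz, Finset.sum_range_succ,
    sum_range_eq_of_zero hfirst]
  refine ⟨by omega, fun he => ?_⟩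
  have hval : ∀ i, i ≠ a → i ≠ a + l + 1 → h i = 0 := by
    intro i h1 h2
    rcases Nat.lt_or_ge i a with h3 | h3
    · exact hfirst i h3
    · rcases Nat.lt_or_ge i (a + l + 1) with h4 | h4
      · exact hz i (by omega) (by omega)
      · exact hlast i (by omega)
  rcases g2 (by omega) with h1 | h1
  · refine ⟨h (a + l + 1), by omega, by omega, Or.inl ?_⟩
    funext j
    unfold extremalHang
    by_cases e1 : j = a
    · subst e1
      rw [if_pos (by omega), h1]
    · rw [if_neg (by omega)]
      by_cases e2 : j = a + l + 1
      · rw [if_pos (by omega), e2]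
      · rw [if_neg (by omega), hval j e1 e2]
  · refine ⟨h a, by omega, by omega, Or.inr ?_⟩
    funext j
    unfold extremalHang
    by_cases e1 : j = 2
    · rw [if_pos e1, show L + 1 - j = a + l + 1 by omega, h1]
    · rw [if_neg e1]
      by_cases e2 : j = h a + 1
      · rw [if_pos e2, show L + 1 - j = a by omega]
      · rw [if_neg e2]
        -- For `j > L + 1` the truncated difference is `0`, where nothing hangs.
        rcases Nat.lt_or_ge (L + 1) j with h3 | h3
        · exact hval _ (by omega) (by omega)
        · exact hval _ (by omega) (by omega)

end QuipuProfile

/-! ### Spectral radius and positive supersolutions -/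

section SpectralRadius

variable {V : Type*} [Fintype V] [DecidableEq V] (G : SimpleGraph V) [DecidableRel G.Adj]

theorem smul_one_sub_adjMatrix_mulVec (c : ℝ) (x : V → ℝ) (v : V) :
    (c • (1 : Matrix V V ℝ) - G.adjMatrix ℝ).mulVec x v =
      c * x v - ∑ w ∈ G.neighborFinset v, x w := by
  simp [Matrix.sub_mulVec, Matrix.smul_mulVec, SimpleGraph.adjMatrix_mulVec_apply]

theorem le_graphSpectralRadius {μ : ℝ} {x : V → ℝ} (hx : x ≠ 0)
    (h : ∀ v, ∑ w ∈ G.neighborFinset v, x w = μ * x v) : μ ≤ graphSpectralRadius G := by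
  refine le_csSup (Module.End.finite_hasEigenvalue _).bddAbove ?_
  refine Module.End.hasEigenvalue_of_hasEigenvector (x := x)
    ⟨Module.End.mem_eigenspace_iff.2 ?_, hx⟩
  funext v
  rw [Matrix.toLin'_apply, SimpleGraph.adjMatrix_mulVec_apply, h v]
  rfl

/-- An eigenvalue `κ` of `c - A` gives the eigenvalue `c - κ` of `A`, which is below `c`. -/
theorem posDef_of_graphSpectralRadius_lt {c : ℝ} (h : graphSpectralRadius G < c) :
    (c • (1 : Matrix V V ℝ) - G.adjMatrix ℝ).PosDef := by
  have hH : (c • (1 : Matrix V V ℝ) - G.adjMatrix ℝ).IsHermitian := by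
    ext i j
    simp [Matrix.one_apply, G.adj_comm, eq_comm]
  rw [hH.posDef_iff_eigenvalues_pos]
  intro i
  have h1 := hH.mulVec_eigenvectorBasis i
  have h2 := le_graphSpectralRadius G (μ := c - hH.eigenvalues i)
    (x := (hH.eigenvectorBasis i).ofLp)
    (by simpa using hH.eigenvectorBasis.orthonormal.ne_zero i) (fun v => by
      have := congrFun h1 v
      rw [smul_one_sub_adjMatrix_mulVec] at this
      simp only [Pi.smul_apply, smul_eq_mul] at this
      linarith)
  linarith

/-- Below `c`, the adjacency matrix has a positive strict supersolution. -/
theorem exists_pos_supersolution {c : ℝ} (hc : 0 < c) (h : graphSpectralRadius G < c) :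
    ∃ y : V → ℝ, (∀ v, 0 < y v) ∧ ∀ v, ∑ w ∈ G.neighborFinset v, y w < c * y v := by
  have hM := posDef_of_graphSpectralRadius_lt G h
  obtain ⟨y, hy⟩ := Matrix.mulVec_surjective_iff_isUnit.2 hM.isUnit (fun _ => 1)
  have hy' : ∀ v, c * y v - ∑ w ∈ G.neighborFinset v, y w = 1 := fun v => by
    rw [← smul_one_sub_adjMatrix_mulVec, hy]
  have hnn : ∀ v, 0 ≤ y v := by
    by_contra! hneg
    -- The negative part `z` of `y` satisfies `z v * ((c - A) z) v ≤ 0` at every vertex, which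
    -- contradicts positive definiteness.
    obtain ⟨u, hu⟩ := hneg
    let z : V → ℝ := fun v => max (-y v) 0
    have hz : z ≠ 0 := fun e => by
      have := congrFun e u
      simp [z] at this
      linarith
    have hpos := hM.dotProduct_mulVec_pos hz
    refine hpos.not_ge (Finset.sum_nonpos fun v _ => ?_)
    rw [smul_one_sub_adjMatrix_mulVec]
    have hzv : 0 ≤ z v := le_max_right _ _
    rw [Pi.star_apply, star_trivial]
    rcases le_or_gt 0 (y v) with h0 | h0
    · simp [z, h0]
    · refine mul_nonpos_of_nonneg_of_nonpos hzv ?_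
      have e : z v = -y v := max_eq_left (by linarith)
      have h3 : ∑ w ∈ G.neighborFinset v, -y w ≤ ∑ w ∈ G.neighborFinset v, z w :=
        Finset.sum_le_sum fun w _ => le_max_left _ _
      rw [Finset.sum_neg_distrib] at h3
      have := hy' v
      rw [e]
      linarith
  have hs : ∀ v, 0 ≤ ∑ w ∈ G.neighborFinset v, y w :=
    fun v => Finset.sum_nonneg fun w _ => hnn w
  refine ⟨y, fun v => ?_, fun v => by linarith [hy' v]⟩
  have h1 := hy' v
  have h2 := hs v
  by_contra hle
  nlinarith [hnn v]

/-- A positive supersolution, strict at some vertex, bounds the spectral radius strictly. -/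
theorem graphSpectralRadius_lt_of_supersolution (hG : G.Connected) {c : ℝ} {y : V → ℝ}
    (hy : ∀ v, 0 < y v) (hle : ∀ v, ∑ w ∈ G.neighborFinset v, y w ≤ c * y v) {v₀ : V}
    (hlt : ∑ w ∈ G.neighborFinset v₀, y w < c * y v₀) : graphSpectralRadius G < c := by
  have hc : 0 < c := by
    have : 0 ≤ ∑ w ∈ G.neighborFinset v₀, y w := Finset.sum_nonneg fun w _ => (hy w).le
    by_contra hc
    nlinarith [hy v₀]
  unfold graphSpectralRadius
  set S : Set ℝ := {x : ℝ | Module.End.HasEigenvalue (Matrix.toLin' (G.adjMatrix ℝ)) x}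
  -- The supremum of the empty set is `0 < c`.
  rcases S.eq_empty_or_nonempty with hS | hS
  · rwa [hS, Real.sSup_empty]
  have hmem : sSup S ∈ S := hS.csSup_mem (Module.End.finite_hasEigenvalue _)
  obtain ⟨x, hx⟩ := Module.End.HasEigenvalue.exists_hasEigenvector hmem
  set μ := sSup S
  have hx1 : ∀ v, ∑ w ∈ G.neighborFinset v, x w = μ * x v := fun v => by
    have := congrFun hx.apply_eq_smul v
    rwa [Matrix.toLin'_apply, SimpleGraph.adjMatrix_mulVec_apply] at this
  by_contra! hμ
  have : Nonempty V := ⟨v₀⟩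
  obtain ⟨u, hu⟩ := Finite.exists_max fun v => |x v| / y v
  set M := |x u| / y u
  have hM : ∀ v, |x v| ≤ M * y v := fun v => (div_le_iff₀ (hy v)).1 (hu v)
  have hMu : |x u| = M * y u := (div_mul_cancel₀ _ (hy u).ne').symm
  have hM0 : 0 < M := by
    obtain ⟨w, hw⟩ := Function.ne_iff.1 hx.2
    have h1 : 0 < |x w| := abs_pos.2 hw
    have h2 := hM w
    by_contra hc
    nlinarith [hy w]
  -- If the largest eigenvalue were at least `c`, then wherever `|x| / y` is maximal it would be
  -- maximal at all neighbours and the supersolution inequality would be an equality. Connectedness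
  -- carries this to `v₀`.
  have hstep : ∀ v, |x v| = M * y v →
      (∀ w ∈ G.neighborFinset v, |x w| = M * y w) ∧
        c * y v ≤ ∑ w ∈ G.neighborFinset v, y w := by
    intro v hv
    have h1 : c * |x v| ≤ ∑ w ∈ G.neighborFinset v, |x w| := by
      calc c * |x v| ≤ |μ| * |x v| :=
            mul_le_mul_of_nonneg_right (hμ.trans (le_abs_self μ)) (abs_nonneg _)
        _ = |∑ w ∈ G.neighborFinset v, x w| := by rw [hx1, abs_mul]
        _ ≤ _ := Finset.abs_sum_le_sum_abs _ _
    have h2 : ∑ w ∈ G.neighborFinset v, |x w| ≤ ∑ w ∈ G.neighborFinset v, M * y w :=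
      Finset.sum_le_sum fun w _ => hM w
    have h3 : ∑ w ∈ G.neighborFinset v, M * y w = M * ∑ w ∈ G.neighborFinset v, y w :=
      (Finset.mul_sum _ _ _).symm
    have h4 := mul_le_mul_of_nonneg_left (hle v) hM0.le
    rw [hv] at h1
    refine ⟨(Finset.sum_eq_sum_iff_of_le fun w _ => hM w).1 (by linarith), ?_⟩
    refine le_of_mul_le_mul_left ?_ hM0
    linarith
  have hall : ∀ v, |x v| = M * y v := by
    intro v
    obtain ⟨p⟩ := hG.preconnected u v
    have : ∀ (a b : V) (p : G.Walk a b), |x a| = M * y a → |x b| = M * y b := by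
      intro a b p
      induction p with
      | nil => exact id
      | cons hadj _ ih =>
        exact fun ha => ih ((hstep _ ha).1 _ ((G.mem_neighborFinset _ _).2 hadj))
    exact this u v p hMu
  exact hlt.not_ge (hstep v₀ (hall v₀)).2

end SpectralRadius

/-! ### Coordinates on a quipu -/

/-- The neighbours of a pair `(i, s)`, standing for the `s`-th vertex of the path hanging from the
`i`-th vertex of the main path (which is itself `(i, 0)`). -/
def chartNbrs : ℕ × ℕ → Finset (ℕ × ℕ)
  | (i, 0) => {(i - 1, 0), (i + 1, 0), (i, 1)}
  | (i, s + 1) => {(i, s), (i, s + 2)}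

/-- The pairs that occur for a main path of `L` vertices and hanging paths of lengths `h`. -/
def ChartValid (L : ℕ) (h : ℕ → ℕ) (p : ℕ × ℕ) : Prop :=
  1 ≤ p.1 ∧ p.1 ≤ L ∧ p.2 ≤ h p.1

/-- An identification of a graph with the quipu whose main path has `L` vertices, the `i`-th of
which carries a hanging path of `h i` vertices. -/
structure QuipuChart {V : Type*} (T : SimpleGraph V) (L : ℕ) (h : ℕ → ℕ) where
  f : ℕ × ℕ → V
  coord : V → ℕ × ℕ
  supp : ∀ j, h j ≠ 0 → 1 ≤ j ∧ j ≤ L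
  valid : ∀ v, ChartValid L h (coord v)
  f_coord : ∀ v, f (coord v) = v
  coord_f : ∀ p, ChartValid L h p → coord (f p) = p
  adj_iff : ∀ v w, T.Adj v w ↔ coord w ∈ chartNbrs (coord v)

section Sequences

variable {V : Type*} {T : SimpleGraph V}

theorem exists_walk_of_seq (g : ℕ → V) (n : ℕ) (hg : ∀ j, j < n → T.Adj (g j) (g (j + 1))) :
    ∃ p : T.Walk (g 0) (g n), p.length = n ∧ (∀ v, v ∈ p.support ↔ ∃ j, j ≤ n ∧ g j = v) ∧
      ((∀ i j, i ≤ n → j ≤ n → g i = g j → i = j) → p.IsPath) := by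
  induction n with
  | zero => exact ⟨.nil, rfl, by simp [eq_comm], fun _ => .nil⟩
  | succ n ih =>
    obtain ⟨p, h1, h2, h3⟩ := ih (fun j hj => hg j (by omega))
    refine ⟨p.concat (hg n (by omega)), by simp [h1], fun v => ?_, fun hinj => ?_⟩
    · rw [SimpleGraph.Walk.support_concat]
      simp only [List.mem_append, h2, List.mem_singleton]
      constructor
      · rintro (⟨j, hj, rfl⟩ | rfl)
        · exact ⟨j, by omega, rfl⟩
        · exact ⟨n + 1, le_rfl, rfl⟩
      · rintro ⟨j, hj, rfl⟩
        rcases Nat.lt_or_ge n j with h4 | h4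
        · right; rw [show j = n + 1 by omega]
        · exact Or.inl ⟨j, h4, rfl⟩
    · refine (h3 fun i j hi hj => hinj i j (by omega) (by omega)).concat ?_ _
      rw [h2]
      rintro ⟨j, hj, he⟩
      have := hinj j (n + 1) (by omega) le_rfl he
      omega

theorem dist_le_of_seq (g : ℕ → V) {a b : ℕ} (hab : a ≤ b)
    (hg : ∀ j, a ≤ j → j < b → T.Adj (g j) (g (j + 1))) : T.dist (g a) (g b) ≤ b - a := by
  obtain ⟨p, h1, -⟩ := exists_walk_of_seq (T := T) (fun j => g (a + j)) (b - a)
    (fun j hj => hg (a + j) (by omega) (by omega))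
  have := SimpleGraph.dist_le p
  simp only [add_zero, show a + (b - a) = b by omega] at this
  omega

theorem reachable_of_seq (g : ℕ → V) {a b : ℕ} (hab : a ≤ b)
    (hg : ∀ j, a ≤ j → j < b → T.Adj (g j) (g (j + 1))) : T.Reachable (g a) (g b) := by
  obtain ⟨p, -⟩ := exists_walk_of_seq (T := T) (fun j => g (a + j)) (b - a)
    (fun j hj => hg (a + j) (by omega) (by omega))
  have := p.reachable
  simpa [show a + (b - a) = b by omega] using this

theorem dist_eq_of_seq (hT : T.IsTree) (g : ℕ → V) (n : ℕ)
    (hg : ∀ j, j < n → T.Adj (g j) (g (j + 1)))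
    (hinj : ∀ i j, i ≤ n → j ≤ n → g i = g j → i = j) : T.dist (g 0) (g n) = n := by
  obtain ⟨p, h1, -, h3⟩ := exists_walk_of_seq g n hg
  obtain ⟨q, hq, hq'⟩ := hT.connected.exists_path_of_dist (g 0) (g n)
  have := (hT.isAcyclic.subsingleton_path _ _).elim ⟨p, h3 hinj⟩ ⟨q, hq⟩
  rw [← hq', ← Subtype.mk.inj this, h1]

end Sequences

theorem mem_chartNbrs_symm {p q : ℕ × ℕ} (hp : 1 ≤ p.1) (hq : 1 ≤ q.1)
    (h : q ∈ chartNbrs p) : p ∈ chartNbrs q := by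
  obtain ⟨i, s⟩ := p
  obtain ⟨j, r⟩ := q
  replace hp : 1 ≤ i := hp
  replace hq : 1 ≤ j := hq
  rcases s with _ | s <;> rcases r with _ | r
  all_goals simp only [chartNbrs, Finset.mem_insert, Finset.mem_singleton, Prod.mk.injEq, and_true]
    at h ⊢
  all_goals omega

theorem card_chartNbrs_le (p : ℕ × ℕ) : (chartNbrs p).card ≤ 3 := by
  obtain ⟨i, _ | s⟩ := p
  · exact Finset.card_le_three
  · exact Finset.card_le_two.trans (by norm_num)

namespace QuipuChart

variable {V : Type*} {T : SimpleGraph V} {L : ℕ} {h : ℕ → ℕ}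

theorem coord_injective (C : QuipuChart T L h) : Function.Injective C.coord :=
  Function.LeftInverse.injective C.f_coord

theorem coord_main (C : QuipuChart T L h) {i : ℕ} (h1 : 1 ≤ i) (h2 : i ≤ L) :
    C.coord (C.f (i, 0)) = (i, 0) := C.coord_f _ ⟨h1, h2, Nat.zero_le _⟩

theorem adj_f (C : QuipuChart T L h) {p q : ℕ × ℕ} (hp : ChartValid L h p)
    (hq : ChartValid L h q) : T.Adj (C.f p) (C.f q) ↔ q ∈ chartNbrs p := by
  rw [C.adj_iff, C.coord_f p hp, C.coord_f q hq]

theorem adj_main (C : QuipuChart T L h) {i : ℕ} (h1 : 1 ≤ i) (h2 : i < L) :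
    T.Adj (C.f (i, 0)) (C.f (i + 1, 0)) :=
  (C.adj_f ⟨h1, h2.le, Nat.zero_le _⟩ ⟨Nat.le_add_left 1 i, Nat.succ_le_of_lt h2, Nat.zero_le _⟩).2
    (by simp [chartNbrs])

theorem adj_hang (C : QuipuChart T L h) {i s : ℕ} (hs : s < h i) :
    T.Adj (C.f (i, s)) (C.f (i, s + 1)) := by
  have h1 := C.supp i (by omega)
  refine (C.adj_f ⟨h1.1, h1.2, hs.le⟩ ⟨h1.1, h1.2, Nat.succ_le_of_lt hs⟩).2 ?_
  rcases s with _ | s <;> simp [chartNbrs]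

/-- The same identification, with the main path traversed in the opposite direction. -/
def reverse (C : QuipuChart T L h) : QuipuChart T L (fun j => h (L + 1 - j)) where
  f p := C.f (L + 1 - p.1, p.2)
  coord v := (L + 1 - (C.coord v).1, (C.coord v).2)
  supp j hj := by
    have := C.supp _ hj
    omega
  valid v := by
    obtain ⟨h1, h2, h3⟩ := C.valid v
    refine ⟨by simp only; omega, by simp only; omega, ?_⟩
    simpa only [show L + 1 - (L + 1 - (C.coord v).1) = (C.coord v).1 by omega] using h3
  f_coord v := by
    obtain ⟨h1, h2, h3⟩ := C.valid v
    simp only [show L + 1 - (L + 1 - (C.coord v).1) = (C.coord v).1 by omega]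
    exact C.f_coord v
  coord_f p hp := by
    obtain ⟨i, s⟩ := p
    obtain ⟨h1, h2, h3⟩ := hp
    simp only at h1 h2 h3
    rw [C.coord_f _ ⟨by simp only; omega, by simp only; omega, h3⟩]
    simp only [show L + 1 - (L + 1 - i) = i by omega]
  adj_iff v w := by
    rw [C.adj_iff]
    obtain ⟨h1, h2, h3⟩ := C.valid v
    obtain ⟨h4, h5, h6⟩ := C.valid w
    generalize C.coord v = p at *
    generalize C.coord w = q at *
    obtain ⟨i, s⟩ := p
    obtain ⟨j, r⟩ := q
    simp only at h1 h2 h3 h4 h5 h6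
    rcases s with _ | s <;>
      simp only [chartNbrs, Finset.mem_insert, Finset.mem_singleton, Prod.mk.injEq] <;> omega

theorem reachable_root (C : QuipuChart T L h) (v : V) : T.Reachable (C.f (1, 0)) v := by
  obtain ⟨h1, h2, h3⟩ := C.valid v
  rw [← C.f_coord v]
  generalize C.coord v = p at *
  obtain ⟨i, s⟩ := p
  refine (reachable_of_seq (fun j => C.f (j, 0)) h1
    (fun j hj hj' => C.adj_main hj (lt_of_lt_of_le hj' h2))).trans ?_
  exact reachable_of_seq (fun j => C.f (i, j)) (Nat.zero_le s)
    (fun j _ hj' => C.adj_hang (lt_of_lt_of_le hj' h3))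

theorem connected (C : QuipuChart T L h) : T.Connected :=
  (SimpleGraph.connected_iff_exists_forall_reachable _).2 ⟨_, C.reachable_root⟩

theorem main_injOn (C : QuipuChart T L h) (i j : ℕ) (hi : i < L) (hj : j < L)
    (he : C.f (i + 1, 0) = C.f (j + 1, 0)) : i = j := by
  have := congrArg C.coord he
  rw [C.coord_main (by omega) (by omega), C.coord_main (by omega) (by omega)] at this
  simpa using this

/-- For `i < j`, going along the main path costs at most `h i + (j - i) + h j ≤ (i - 1) + (j - i) +
(L - j) = L - 1`. -/
theorem diam_le (C : QuipuChart T L h) (h1 : ∀ i, 1 ≤ i → i ≤ L → h i + 1 ≤ i)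
    (h2 : ∀ i, 1 ≤ i → i ≤ L → h i + i ≤ L) : T.diam ≤ L - 1 := by
  have : Nonempty V := ⟨C.f (1, 0)⟩
  have key : ∀ u v, (C.coord u).1 ≤ (C.coord v).1 → T.dist u v ≤ L - 1 := by
    intro u v huv
    obtain ⟨a1, a2, a3⟩ := C.valid u
    obtain ⟨b1, b2, b3⟩ := C.valid v
    rw [← C.f_coord u, ← C.f_coord v]
    generalize C.coord u = p at *
    generalize C.coord v = q at *
    obtain ⟨i, s⟩ := p
    obtain ⟨j, r⟩ := q
    dsimp only at a1 a2 a3 b1 b2 b3 huv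
    have ha := h1 i a1 a2
    have hb := h2 j b1 b2
    rcases huv.eq_or_lt with rfl | hlt
    · have hd : ∀ s r, s ≤ r → r ≤ h i → T.dist (C.f (i, s)) (C.f (i, r)) ≤ r - s :=
        fun s r hsr hr => dist_le_of_seq (fun j => C.f (i, j)) hsr
          (fun j _ hj' => C.adj_hang (lt_of_lt_of_le hj' hr))
      rcases le_total s r with hsr | hsr
      · have := hd s r hsr b3
        omega
      · have := hd r s hsr a3
        rw [SimpleGraph.dist_comm]
        omega
    · have e1 := dist_le_of_seq (T := T) (fun j => C.f (i, j)) (Nat.zero_le s)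
          (fun j _ hj' => C.adj_hang (lt_of_lt_of_le hj' a3))
      have e2 := dist_le_of_seq (T := T) (fun k => C.f (j, k)) (Nat.zero_le r)
          (fun j _ hj' => C.adj_hang (lt_of_lt_of_le hj' b3))
      have e3 := dist_le_of_seq (T := T) (fun j => C.f (j, 0)) huv
        (fun k hk hk' => C.adj_main (by omega) (by omega))
      rw [SimpleGraph.dist_comm] at e1
      have t1 := C.connected.dist_triangle (u := C.f (i, s)) (v := C.f (i, 0)) (w := C.f (j, 0))
      have t2 := C.connected.dist_triangle (u := C.f (i, s)) (v := C.f (j, 0)) (w := C.f (j, r))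
      omega
  obtain ⟨u, v, huv⟩ := T.exists_dist_eq_diam
  rw [← huv]
  rcases le_total (C.coord u).1 (C.coord v).1 with hle | hle
  · exact key u v hle
  · rw [SimpleGraph.dist_comm]
    exact key v u hle

section Fintype

variable [Fintype V]

theorem le_diam_of_isTree (C : QuipuChart T L h) (hT : T.IsTree) (hL : 1 ≤ L) :
    L - 1 ≤ T.diam := by
  have : Nonempty V := ⟨C.f (1, 0)⟩
  have h1 := dist_eq_of_seq hT (fun j => C.f (j + 1, 0)) (L - 1)
    (fun j hj => C.adj_main (by omega) (by omega))
    (fun i j hi hj => C.main_injOn i j (by omega) (by omega))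
  rw [← h1]
  exact SimpleGraph.dist_le_diam (SimpleGraph.connected_iff_ediam_ne_top.1 hT.connected)

theorem card_eq (C : QuipuChart T L h) :
    Fintype.card V = L + ∑ i ∈ Finset.range (L + 1), h i := by
  classical
  have h0 : h 0 = 0 := by
    by_contra hc
    have := C.supp _ hc
    omega
  have e : (Finset.univ : Finset V).image C.coord =
      (Finset.Ico 1 (L + 1)).biUnion fun i => (Finset.range (h i + 1)).image (Prod.mk i) := by
    ext ⟨i, s⟩
    simp only [Finset.mem_image, Finset.mem_univ, true_and, Finset.mem_biUnion, Finset.mem_Ico,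
      Finset.mem_range, Prod.mk.injEq]
    constructor
    · rintro ⟨v, hv⟩
      obtain ⟨h1, h2, h3⟩ := C.valid v
      rw [hv] at h1 h2 h3
      exact ⟨i, ⟨h1, Nat.lt_succ_of_le h2⟩, s, Nat.lt_succ_of_le h3, rfl, rfl⟩
    · rintro ⟨j, hj, r, hr, rfl, rfl⟩
      exact ⟨_, C.coord_f (j, r) ⟨hj.1, by omega, by simp only; omega⟩⟩
  have hs : ∑ i ∈ Finset.range (L + 1), h i = ∑ i ∈ Finset.Ico 1 (L + 1), h i := by
    rw [Finset.range_eq_Ico, Finset.sum_eq_sum_Ico_succ_bot (by omega : 0 < L + 1), h0, zero_add]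
  have h1 := Finset.card_image_of_injective Finset.univ C.coord_injective
  rw [e, Finset.card_biUnion] at h1
  · rw [Finset.card_univ] at h1
    rw [← h1, Finset.sum_congr rfl fun i _ => Finset.card_image_of_injective _
      (Prod.mk_right_injective i)]
    simp only [Finset.card_range, Finset.sum_add_distrib, Finset.sum_const, Nat.card_Ico,
      smul_eq_mul, mul_one]
    rw [hs]
    omega
  · intro i _ j _ hij
    rw [Function.onFun, Finset.disjoint_left]
    intro p hp hq
    obtain ⟨s, -, rfl⟩ := Finset.mem_image.1 hp
    obtain ⟨r, -, hr⟩ := Finset.mem_image.1 hq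
    exact hij (Prod.mk.inj hr).1.symm

variable [DecidableRel T.Adj]

theorem degree_le (C : QuipuChart T L h) (v : V) : T.degree v ≤ (chartNbrs (C.coord v)).card := by
  classical
  rw [← T.card_neighborFinset_eq_degree,
    ← Finset.card_image_of_injective _ C.coord_injective]
  refine Finset.card_le_card fun q hq => ?_
  obtain ⟨w, hw, rfl⟩ := Finset.mem_image.1 hq
  exact (C.adj_iff v w).1 ((T.mem_neighborFinset v w).1 hw)

/-- `chartNbrs` also lists pairs that name no vertex; extending by zero makes them harmless. -/
theorem sum_neighborFinset (C : QuipuChart T L h) {F : ℕ × ℕ → ℝ}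
    (hF : ∀ p, ¬ ChartValid L h p → F p = 0) (v : V) :
    ∑ w ∈ T.neighborFinset v, F (C.coord w) = ∑ q ∈ chartNbrs (C.coord v), F q := by
  classical
  rw [← Finset.sum_image (f := F) (fun a _ b _ hab => C.coord_injective hab)]
  refine Finset.sum_subset (fun q hq => ?_) (fun q hq hq' => hF q fun hv => hq' ?_)
  · obtain ⟨w, hw, rfl⟩ := Finset.mem_image.1 hq
    exact (C.adj_iff v w).1 ((T.mem_neighborFinset v w).1 hw)
  · refine Finset.mem_image.2 ⟨C.f q, ?_, C.coord_f q hv⟩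
    rw [T.mem_neighborFinset, C.adj_iff, C.coord_f q hv]
    exact hq

end Fintype

end QuipuChart

/-! ### Charted graphs are open quipus; from spectral radius to profile -/

namespace QuipuChart

variable {V : Type*} {T : SimpleGraph V} {L : ℕ} {h : ℕ → ℕ} [Fintype V]

theorem isTree (C : QuipuChart T L h) : T.IsTree := by
  classical
  have hconn := C.connected
  have : Nonempty V := hconn.nonempty
  refine SimpleGraph.isTree_iff_connected_and_card.2 ⟨hconn, ?_⟩
  refine le_antisymm ?_ hconn.card_vert_le_card_edgeSet_add_one
  -- Every edge joins a vertex other than the root `(1, 0)` to its parent, so there are at most `|V|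
  -- - 1` edges.
  let parent : ℕ × ℕ → ℕ × ℕ := fun p => if p.2 = 0 then (p.1 - 1, 0) else (p.1, p.2 - 1)
  have hsub : T.edgeSet ⊆ (fun v => s(v, C.f (parent (C.coord v)))) '' {v | v ≠ C.f (1, 0)} := by
    have key : ∀ v w, T.Adj v w → C.coord w = parent (C.coord v) →
        s(v, w) ∈ (fun v => s(v, C.f (parent (C.coord v)))) '' {v | v ≠ C.f (1, 0)} := by
      intro v w _ hvw
      refine ⟨v, ?_, ?_⟩
      · rintro rfl
        have hw := C.valid w
        have hL : 1 ≤ L := hw.1.trans hw.2.1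
        rw [hvw, C.coord_main le_rfl hL] at hw
        have := hw.1
        simp [parent] at this
      · simp only
        rw [← hvw, C.f_coord]
    intro e he
    induction e using Sym2.ind with
    | _ v w =>
      rw [SimpleGraph.mem_edgeSet] at he
      have hmem := (C.adj_iff v w).1 he
      obtain ⟨h1, -, -⟩ := C.valid v
      obtain ⟨h4, -, -⟩ := C.valid w
      have hor : C.coord w = parent (C.coord v) ∨ C.coord v = parent (C.coord w) := by
        generalize C.coord v = p at *
        generalize C.coord w = q at *
        obtain ⟨i, s⟩ := p
        obtain ⟨j, r⟩ := q
        replace h1 : 1 ≤ i := h1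
        replace h4 : 1 ≤ j := h4
        rcases s with _ | s
        · simp only [chartNbrs, Finset.mem_insert, Finset.mem_singleton, Prod.mk.injEq] at hmem
          rcases hmem with ⟨rfl, rfl⟩ | ⟨rfl, rfl⟩ | ⟨rfl, rfl⟩ <;> simp [parent]
        · simp only [chartNbrs, Finset.mem_insert, Finset.mem_singleton, Prod.mk.injEq] at hmem
          rcases hmem with ⟨rfl, rfl⟩ | ⟨rfl, rfl⟩ <;> simp [parent]
      rcases hor with hor | hor
      · exact key v w he hor
      · rw [Sym2.eq_swap]
        exact key w v he.symm hor
  have h1 := Set.ncard_le_ncard hsub (Set.toFinite _)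
  have h2 := Set.ncard_image_le (f := fun v => s(v, C.f (parent (C.coord v))))
    (Set.toFinite {v | v ≠ C.f (1, 0)})
  have h3 : {v | v ≠ C.f (1, 0)}.ncard + 1 = Nat.card V := by
    have := Set.ncard_add_ncard_compl {C.f (1, 0)}
    rw [Set.ncard_singleton] at this
    rw [← this, add_comm]
    rfl
  rw [← Nat.card_coe_set_eq] at h1
  omega

theorem isOpenQuipu (C : QuipuChart T L h) [DecidableRel T.Adj] (hL : 1 ≤ L) :
    IsOpenQuipu T := by
  refine ⟨C.isTree, fun v => (C.degree_le v).trans (card_chartNbrs_le _), ?_⟩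
  obtain ⟨p, -, h2, h3⟩ := exists_walk_of_seq (T := T) (fun j => C.f (j + 1, 0)) (L - 1)
    (fun j hj => C.adj_main (by omega) (by omega))
  refine ⟨_, _, p, h3 fun i j hi hj => C.main_injOn i j (by omega) (by omega), fun w hw => ?_⟩
  rw [h2]
  have hd := C.degree_le w
  obtain ⟨h4, h5, h6⟩ := C.valid w
  rw [← C.f_coord w]
  rw [hw] at hd
  generalize C.coord w = q at *
  obtain ⟨i, _ | s⟩ := q
  · refine ⟨i - 1, by simp only at h5; omega, ?_⟩
    simp only at h4
    simp only [Nat.sub_add_cancel h4]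
  · exact absurd (hd.trans Finset.card_le_two) (by norm_num)

theorem sum_chartNbrs_main (F : ℕ × ℕ → ℝ) (i : ℕ) :
    ∑ q ∈ chartNbrs (i, 0), F q = F (i - 1, 0) + F (i + 1, 0) + F (i, 1) := by
  have h1 : ((i - 1, 0) : ℕ × ℕ) ∉ ({(i + 1, 0), (i, 1)} : Finset (ℕ × ℕ)) := by
    simp only [Finset.mem_insert, Finset.mem_singleton, Prod.mk.injEq]
    omega
  have h2 : ((i + 1, 0) : ℕ × ℕ) ∉ ({(i, 1)} : Finset (ℕ × ℕ)) := by
    simp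
  rw [chartNbrs, Finset.sum_insert h1, Finset.sum_insert h2, Finset.sum_singleton]
  ring

theorem sum_chartNbrs_hang (F : ℕ × ℕ → ℝ) (i s : ℕ) :
    ∑ q ∈ chartNbrs (i, s + 1), F q = F (i, s) + F (i, s + 2) := by
  rw [chartNbrs, Finset.sum_pair (by simp)]

/-- A path of `n` vertices hanging from a vertex forces a lower bound for the value of a
supersolution at its first vertex. -/
theorem hang_lower_bound {t : ℝ} (ht : 0 < t) (htt : t * t = 2) {x : ℕ → ℝ} (n : ℕ)
    (hend : x (n + 1) = 0)
    (hx : ∀ s, s < n → x s + x (s + 2) < 3 / 2 * t * x (s + 1)) :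
    (2 * 2 ^ n - 2) * x 0 ≤ (2 * 2 ^ n - 1) * (t * x 1) := by
  -- Read from the free end and rescaled by powers of `t`, the hanging path satisfies the main-path
  -- recurrence with initial value zero.
  have h1 := QuipuProfile.prefix_le (U := fun j => 2 ^ j * (t ^ (n + 1 - j) * x (n + 1 - j)))
    (by simp [hend]) n (fun i hi => by
      have h2 := hx (n - 1 - i) (by omega)
      simp only [show n + 1 - i = n - 1 - i + 2 by omega,
        show n + 1 - (i + 2) = n - 1 - i by omega, show n + 1 - (i + 1) = n - 1 - i + 1 by omega]
      generalize n - 1 - i = e at *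
      have h3 : (0 : ℝ) < 2 ^ i * t ^ e := by positivity
      have h4 := mul_lt_mul_of_pos_left h2 h3
      have e1 : (2 : ℝ) * (2 ^ i * (t ^ (e + 2) * x (e + 2))) +
          2 ^ (i + 2) * (t ^ e * x e) = 4 * (2 ^ i * t ^ e * (x e + x (e + 2))) := by
        rw [pow_add t e 2, pow_two, htt]; ring
      have e2 : (3 : ℝ) * (2 ^ (i + 1) * (t ^ (e + 1) * x (e + 1))) =
          4 * (2 ^ i * t ^ e * (3 / 2 * t * x (e + 1))) := by ring
      rw [e1, e2]
      linarith)
  simp only [Nat.sub_self, show n + 1 - n = 1 by omega, pow_zero, pow_one, one_mul] at h1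
  have h3 : (0 : ℝ) < 2 ^ n := by positivity
  refine le_of_mul_le_mul_left ?_ h3
  rw [pow_succ (2 : ℝ) n] at h1
  linarith

theorem exists_profile (C : QuipuChart T L h) [DecidableEq V] [DecidableRel T.Adj]
    (hρ : graphSpectralRadius T < 3 / 2 * Real.sqrt 2)
    (hfirst : ∀ a, h a ≠ 0 → (∀ i, i < a → h i = 0) → h a + 1 ≤ a)
    (hlast : ∀ b, h b ≠ 0 → (∀ i, b < i → h i = 0) → h b + b ≤ L) :
    ∃ Z, QuipuProfile L h Z := by
  classical
  have ht : 0 < Real.sqrt 2 := by positivity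
  have htt : Real.sqrt 2 * Real.sqrt 2 = 2 := Real.mul_self_sqrt (by norm_num)
  obtain ⟨y, hy, hlt⟩ := exists_pos_supersolution T (by positivity) hρ
  generalize Real.sqrt 2 = t at *
  let F : ℕ × ℕ → ℝ := fun p => if ChartValid L h p then y (C.f p) else 0
  have hF0 : ∀ p, ¬ ChartValid L h p → F p = 0 := fun p hp => if_neg hp
  have hFpos : ∀ p, ChartValid L h p → 0 < F p := fun p hp => by
    simp only [F, if_pos hp]
    exact hy _
  have hFy : ∀ v, F (C.coord v) = y v := fun v => by
    simp only [F, if_pos (C.valid v), C.f_coord]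
  have hsuper : ∀ p, ChartValid L h p → ∑ q ∈ chartNbrs p, F q < 3 / 2 * t * F p := by
    intro p hp
    have h1 := C.sum_neighborFinset hF0 (C.f p)
    rw [C.coord_f p hp] at h1
    rw [← h1]
    have h2 := hlt (C.f p)
    rw [← hFy (C.f p), C.coord_f p hp] at h2
    simpa only [hFy] using h2
  have hhang : ∀ i, 1 ≤ i → i ≤ L →
      (2 * 2 ^ h i - 2) * F (i, 0) ≤ (2 * 2 ^ h i - 1) * (t * F (i, 1)) := by
    intro i h1 h2
    refine hang_lower_bound (x := fun s => F (i, s)) ht htt (h i)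
      (hF0 _ fun hc => absurd hc.2.2 (by simp)) fun s hs => ?_
    have := hsuper (i, s + 1) ⟨h1, h2, hs⟩
    rwa [sum_chartNbrs_hang] at this
  refine ⟨fun j => t ^ j * F (j, 0), C.supp, ?_, ?_, ?_, ?_, hfirst, hlast⟩
  · simp [hF0 (0, 0) fun hc => absurd hc.1 (by simp)]
  · simp [hF0 (L + 1, 0) fun hc => absurd hc.2.1 (by simp)]
  · intro j h1 h2
    have := hFpos (j, 0) ⟨h1, h2, Nat.zero_le _⟩
    positivity
  · intro j hj
    have h1 := hsuper (j + 1, 0) ⟨Nat.le_add_left 1 j, hj, Nat.zero_le _⟩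
    have h2 := hhang (j + 1) (by omega) (by omega)
    rw [sum_chartNbrs_main, Nat.add_sub_cancel] at h1
    have hA := QuipuProfile.one_le_two_pow (h (j + 1))
    set A : ℝ := 2 ^ h (j + 1)
    have e1 := mul_lt_mul_of_pos_left h1 (show 0 < 2 * A - 1 by linarith)
    have h3 : 0 < t ^ j := by positivity
    have e2 : (2 * A - 1) * (F (j, 0) + F (j + 2, 0)) * t <
        (4 * A - 1) * F (j + 1, 0) := by
      have e3 := mul_lt_mul_of_pos_right e1 ht
      have e4 : (2 * A - 1) * (3 / 2 * t * F (j + 1, 0)) * t =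
          (2 * A - 1) * (3 * F (j + 1, 0)) := by
        linear_combination (2 * A - 1) * (3 / 2) * F (j + 1, 0) * htt
      rw [e4] at e3
      linarith
    have e5 := mul_lt_mul_of_pos_left e2 (mul_pos h3 ht)
    have e6 : (2 * A - 1) * (2 * (t ^ j * F (j, 0)) + t ^ (j + 2) * F (j + 2, 0)) =
        t ^ j * t * ((2 * A - 1) * (F (j, 0) + F (j + 2, 0)) * t) := by
      rw [pow_add, pow_two, htt]
      linear_combination -(t ^ j * (2 * A - 1) * (F (j, 0) + F (j + 2, 0))) * htt
    rw [e6, pow_succ]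
    linarith

end QuipuChart

/-! ### The extremal trees -/

/-- An integral supersolution on `P_{(1,m-2,m)}^{(1,m)}`, up to powers of `√2`. -/
noncomputable def extremalWeight (m : ℕ) : ℕ × ℕ → ℝ
  | (i, 0) =>
    if i = 0 then 0 else if i = 1 then 2 * (2 ^ (m + 1) - 1)
    else if i ≤ m + 1 then (2 ^ (m + 1) - 1) * (2 + 2 ^ i)
    else if i ≤ 2 * m + 1 then (2 + 2 ^ (m + 1)) * (2 ^ (m + 1) - 2 ^ (i - (m + 1)))
    else 0
  | (i, s + 1) =>
    if i = 2 ∧ s = 0 then 4 * (2 ^ (m + 1) - 1)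
    else if i = m + 1 ∧ s + 1 ≤ m then (2 + 2 ^ (m + 1)) * (2 ^ (m + 1) - 2 ^ (s + 1))
    else 0

section Extremal

variable {m : ℕ}

theorem extremalHang_supp (hm : 2 ≤ m) (j : ℕ) (hj : extremalHang m j ≠ 0) :
    1 ≤ j ∧ j ≤ 2 * m + 1 := by
  unfold extremalHang at hj
  split_ifs at hj <;> omega

theorem extremalHang_two (m : ℕ) : extremalHang m 2 = 1 := rfl

theorem extremalHang_add_one (hm : 2 ≤ m) : extremalHang m (m + 1) = m := by
  unfold extremalHang
  rw [if_neg (by omega), if_pos rfl]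

theorem extremalWeight_one (m : ℕ) : extremalWeight m (1, 0) = 2 * (2 ^ (m + 1) - 1) := by
  simp [extremalWeight]

theorem extremalWeight_low {i : ℕ} (h1 : 2 ≤ i) (h2 : i ≤ m + 1) :
    extremalWeight m (i, 0) = (2 ^ (m + 1) - 1) * (2 + 2 ^ i) := by
  rw [extremalWeight, if_neg (by omega), if_neg (by omega), if_pos h2]

theorem extremalWeight_high (hm : 2 ≤ m) {s : ℕ} (hs : s ≤ m + 1) :
    extremalWeight m (m + 1 + s, 0) = (2 + 2 ^ (m + 1)) * (2 ^ (m + 1) - 2 ^ s) := by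
  rcases Nat.eq_zero_or_pos s with rfl | h0
  · rw [add_zero, extremalWeight_low (by omega) le_rfl, pow_zero]
    ring
  · rw [extremalWeight, if_neg (by omega), if_neg (by omega), if_neg (by omega)]
    split_ifs with h
    · rw [Nat.add_sub_cancel_left]
    · rw [show s = m + 1 by omega, sub_self, mul_zero]

theorem extremalWeight_hang_two (m : ℕ) :
    extremalWeight m (2, 1) = 4 * (2 ^ (m + 1) - 1) := by
  simp [extremalWeight]

theorem extremalWeight_hang (hm : 2 ≤ m) {s : ℕ} (hs : s ≤ m + 1) :
    extremalWeight m (m + 1, s) = (2 + 2 ^ (m + 1)) * (2 ^ (m + 1) - 2 ^ s) := by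
  rcases s with _ | s
  · exact extremalWeight_high hm (Nat.zero_le _)
  · rw [extremalWeight, if_neg (by omega)]
    split_ifs with h
    · rfl
    · rw [show s + 1 = m + 1 by omega, sub_self, mul_zero]

theorem extremalWeight_eq_zero (hm : 2 ≤ m) (p : ℕ × ℕ)
    (hp : ¬ ChartValid (2 * m + 1) (extremalHang m) p) : extremalWeight m p = 0 := by
  obtain ⟨i, _ | s⟩ := p
  · rw [extremalWeight]
    have : ¬ (1 ≤ i ∧ i ≤ 2 * m + 1) := fun h => hp ⟨h.1, h.2, Nat.zero_le _⟩
    split_ifs <;> first | rfl | omega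
  · rw [extremalWeight]
    split_ifs with h1 h2
    · obtain ⟨rfl, rfl⟩ := h1
      exact absurd ⟨by norm_num, by simp only; omega, le_rfl⟩ hp
    · obtain ⟨rfl, h2⟩ := h2
      refine absurd ⟨by simp, by simp only; omega, ?_⟩ hp
      simpa only [extremalHang_add_one hm] using h2
    · rfl

theorem extremalWeight_pos (hm : 2 ≤ m) (p : ℕ × ℕ)
    (hp : ChartValid (2 * m + 1) (extremalHang m) p) : 0 < extremalWeight m p := by
  obtain ⟨i, s⟩ := p
  obtain ⟨h1, h2, h3⟩ := hp
  dsimp only at h1 h2 h3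
  have hB : (2 : ℝ) ≤ 2 ^ (m + 1) := QuipuProfile.two_le_two_pow (by omega)
  have hlt : ∀ s, s ≤ m → (2 : ℝ) ^ s < 2 ^ (m + 1) :=
    fun s hs => pow_lt_pow_right₀ (by norm_num) (by omega)
  rcases s with _ | s
  · rcases Nat.lt_or_ge (m + 1) i with h4 | h4
    · obtain ⟨s, rfl⟩ := Nat.exists_eq_add_of_le h4.le
      rw [extremalWeight_high hm (by omega)]
      exact mul_pos (by linarith) (sub_pos.2 (hlt _ (by omega)))
    · rcases h1.eq_or_lt with rfl | h5
      · rw [extremalWeight_one]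
        linarith
      · rw [extremalWeight_low h5 h4]
        exact mul_pos (by linarith) (by positivity)
  · unfold extremalHang at h3
    split_ifs at h3 with h4 h5
    · obtain rfl : s = 0 := by omega
      subst h4
      rw [extremalWeight_hang_two]
      linarith
    · subst h5
      rw [extremalWeight_hang hm (by omega)]
      exact mul_pos (by linarith) (sub_pos.2 (hlt _ h3))
    · omega

theorem extremalWeight_hang_ineq (hm : 2 ≤ m) {i s : ℕ} (hs : s + 1 ≤ extremalHang m i) :
    2 * extremalWeight m (i, s) + extremalWeight m (i, s + 2) ≤
      3 * extremalWeight m (i, s + 1) := by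
  unfold extremalHang at hs
  split_ifs at hs with h4 h5
  · obtain rfl : s = 0 := by omega
    subst h4
    rw [extremalWeight_hang_two, extremalWeight_low le_rfl (by omega),
      extremalWeight_eq_zero hm (2, 0 + 2) (fun hc => absurd hc.2.2 (by simp [extremalHang]))]
    linarith
  · subst h5
    rw [extremalWeight_hang hm (by omega), extremalWeight_hang hm (by omega),
      extremalWeight_hang hm (by omega), pow_succ _ (s + 1), pow_succ _ s]
    linarith
  · omega

/-- The only vertex where the eigenvalue equation fails: with `B = 2^(m+1)` the sides are `3B² + 3B
- 12` and `3B² + 3B - 6`. -/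
theorem extremalWeight_branch (hm : 2 ≤ m) :
    2 * extremalWeight m (m, 0) + extremalWeight m (m + 2, 0) + extremalWeight m (m + 1, 1) <
      3 * extremalWeight m (m + 1, 0) := by
  rw [extremalWeight_low hm (by omega), extremalWeight_low (by omega) le_rfl,
    extremalWeight_high hm (s := 1) (by omega), extremalWeight_hang hm (by omega),
    pow_succ _ m]
  nlinarith

theorem extremalWeight_main (hm : 2 ≤ m) {i : ℕ} (h1 : 1 ≤ i) (h2 : i ≤ 2 * m + 1) :
    2 * extremalWeight m (i - 1, 0) + extremalWeight m (i + 1, 0) + extremalWeight m (i, 1) ≤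
      3 * extremalWeight m (i, 0) := by
  by_cases hi : i = m + 1
  · subst hi
    exact (extremalWeight_branch hm).le
  by_cases hi2 : i = 2
  · subst hi2
    rw [extremalWeight_one, extremalWeight_low (by omega) (by omega),
      extremalWeight_low (by omega) (by omega), extremalWeight_hang_two]
    exact le_of_eq (by ring)
  rw [extremalWeight_eq_zero hm (i, 1) fun hc => absurd hc.2.2 (by
    simp [extremalHang, hi, hi2])]
  by_cases hi1 : i = 1
  · subst hi1
    rw [extremalWeight_eq_zero hm (1 - 1, 0) fun hc => absurd hc.1 (by simp), extremalWeight_one,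
      extremalWeight_low (by omega) (by omega)]
    exact le_of_eq (by ring)
  rcases Nat.lt_or_ge i (m + 1) with h3 | h3
  · obtain ⟨j, rfl⟩ := Nat.exists_eq_add_of_le h1
    rw [Nat.add_sub_cancel_left, extremalWeight_low (by omega) (by omega),
      extremalWeight_low (by omega) (by omega), extremalWeight_low (by omega) (by omega)]
    exact le_of_eq (by ring)
  · obtain ⟨s, rfl⟩ : ∃ s, i = m + 1 + (s + 1) := ⟨i - (m + 1) - 1, by omega⟩
    rw [show m + 1 + (s + 1) - 1 = m + 1 + s by omega,
      show m + 1 + (s + 1) + 1 = m + 1 + (s + 2) by omega, extremalWeight_high hm (by omega),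
      extremalWeight_high hm (by omega), extremalWeight_high hm (by omega), pow_succ _ (s + 1),
      pow_succ _ s]
    linarith

variable {V : Type*} [Fintype V] {T : SimpleGraph V}

theorem QuipuChart.graphSpectralRadius_lt [DecidableEq V] [DecidableRel T.Adj] (hm : 2 ≤ m)
    (C : QuipuChart T (2 * m + 1) (extremalHang m)) :
    graphSpectralRadius T < 3 / 2 * Real.sqrt 2 := by
  obtain ⟨r, hr0, hrr, hr⟩ : ∃ r : ℝ, 0 < r ∧ r * r = 1 / 2 ∧ 3 / 2 * Real.sqrt 2 = 3 * r := by
    have : Real.sqrt 2 * Real.sqrt 2 = 2 := Real.mul_self_sqrt (by norm_num)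
    refine ⟨Real.sqrt 2 / 2, by positivity, by linarith, by ring⟩
  rw [hr]
  -- With `r = 1/√2` the threshold is `3r`, and the powers of `r` turn the inequality at each vertex
  -- into an integral one with coefficients `2`, `1` and `3`.
  let F : ℕ × ℕ → ℝ := fun p => extremalWeight m p * r ^ (p.1 + p.2)
  have hF0 : ∀ p, ¬ ChartValid (2 * m + 1) (extremalHang m) p → F p = 0 := fun p hp => by
    simp only [F, extremalWeight_eq_zero hm p hp, zero_mul]
  have hmain : ∀ i, ∑ q ∈ chartNbrs (i + 1, 0), F q = r ^ i / 2 * (2 * extremalWeight m (i, 0) +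
      extremalWeight m (i + 2, 0) + extremalWeight m (i + 1, 1)) := by
    intro i
    rw [QuipuChart.sum_chartNbrs_main]
    simp only [F, Nat.add_sub_cancel, add_zero, pow_succ]
    linear_combination (extremalWeight m (i + 1 + 1, 0) + extremalWeight m (i + 1, 1)) * r ^ i * hrr
  have hFm : ∀ i, 3 * r * F (i + 1, 0) = r ^ i / 2 * (3 * extremalWeight m (i + 1, 0)) := by
    intro i
    simp only [F, add_zero, pow_succ]
    linear_combination 3 * extremalWeight m (i + 1, 0) * r ^ i * hrr
  have hle : ∀ v, ∑ w ∈ T.neighborFinset v, F (C.coord w) ≤ 3 * r * F (C.coord v) := by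
    intro v
    rw [C.sum_neighborFinset hF0]
    obtain ⟨h1, h2, h3⟩ := C.valid v
    generalize C.coord v = p at *
    obtain ⟨i, s⟩ := p
    dsimp only at h1 h2 h3
    rcases s with _ | s
    · obtain ⟨j, rfl⟩ : ∃ j, i = j + 1 := ⟨i - 1, by omega⟩
      rw [hmain, hFm]
      exact mul_le_mul_of_nonneg_left (extremalWeight_main hm h1 h2) (by positivity)
    · rw [QuipuChart.sum_chartNbrs_hang]
      have h4 := mul_le_mul_of_nonneg_left (extremalWeight_hang_ineq hm h3)
        (show 0 ≤ r ^ (i + s) / 2 by positivity)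
      simp only [F, ← add_assoc, pow_succ]
      have e1 : 3 * r * (extremalWeight m (i, s + 1) * (r ^ (i + s) * r)) =
          r ^ (i + s) / 2 * (3 * extremalWeight m (i, s + 1)) := by
        linear_combination 3 * extremalWeight m (i, s + 1) * r ^ (i + s) * hrr
      have e2 : extremalWeight m (i, s + 2) * (r ^ (i + s) * r * r) =
          r ^ (i + s) / 2 * extremalWeight m (i, s + 2) := by
        linear_combination extremalWeight m (i, s + 2) * r ^ (i + s) * hrr
      rw [e1, e2]
      linarith
  refine graphSpectralRadius_lt_of_supersolution T C.connected (y := fun v => F (C.coord v))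
    (fun v => mul_pos (extremalWeight_pos hm _ (C.valid v)) (by positivity)) hle
    (v₀ := C.f (m + 1, 0)) ?_
  rw [C.sum_neighborFinset hF0, C.coord_main (by omega) (by omega), hmain, hFm]
  exact mul_lt_mul_of_pos_left (extremalWeight_branch hm) (by positivity)

theorem sum_extremalHang (hm : 2 ≤ m) :
    ∑ i ∈ Finset.range (2 * m + 1 + 1), extremalHang m i = m + 1 := by
  have e : ∀ i, extremalHang m i = (if i = 2 then 1 else 0) + (if i = m + 1 then m else 0) := by
    intro i
    unfold extremalHang
    split_ifs <;> omega
  simp only [e, Finset.sum_add_distrib, Finset.sum_ite_eq', Finset.mem_range]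
  rw [if_pos (by omega), if_pos (by omega), add_comm]

theorem QuipuChart.diam_eq (hm : 2 ≤ m) (C : QuipuChart T (2 * m + 1) (extremalHang m)) :
    T.diam = 2 * m := by
  refine le_antisymm ?_ (C.le_diam_of_isTree C.isTree (by omega))
  refine C.diam_le ?_ ?_ <;>
  · intro i h1 h2
    unfold extremalHang
    split_ifs <;> omega

theorem QuipuChart.card_eq_of_extremal (hm : 2 ≤ m)
    (C : QuipuChart T (2 * m + 1) (extremalHang m)) : Fintype.card V = 3 * m + 2 := by
  rw [C.card_eq, sum_extremalHang hm]
  omega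

end Extremal

/-! ### Every open quipu has a chart along a longest main path -/

theorem Nat.exists_greatest {P : ℕ → Prop} {n B : ℕ} (hn : P n) (hB : ∀ k, P k → k ≤ B) :
    ∃ k, P k ∧ ∀ l, P l → l ≤ k := by
  classical
  exact ⟨Nat.findGreatest P B, Nat.findGreatest_spec (hB n hn) hn,
    fun l hl => Nat.le_findGreatest (hB l hl) hl⟩

/-- The sequence `g 1, …, g L` is a path through all vertices of degree `3`. -/
structure IsMainPath {V : Type*} [Fintype V] (T : SimpleGraph V) [DecidableRel T.Adj]
    (L : ℕ) (g : ℕ → V) : Prop where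
  pos : 1 ≤ L
  adj : ∀ i, 1 ≤ i → i < L → T.Adj (g i) (g (i + 1))
  inj : ∀ i j, 1 ≤ i → i ≤ L → 1 ≤ j → j ≤ L → g i = g j → i = j
  covers : ∀ w, T.degree w = 3 → ∃ i, 1 ≤ i ∧ i ≤ L ∧ g i = w

/-- The pairs `(i, s)` with `s ≤ h i` are placed injectively so that the main path and the hanging
paths are paths of `T`. -/
structure IsQuipuPlacement {V : Type*} (T : SimpleGraph V) (L : ℕ) (g : ℕ → V) (h : ℕ → ℕ)
    (f : ℕ × ℕ → V) : Prop where
  supp : ∀ j, h j ≠ 0 → 1 ≤ j ∧ j ≤ L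
  main : ∀ i, 1 ≤ i → i ≤ L → f (i, 0) = g i
  hang : ∀ i s, s < h i → T.Adj (f (i, s)) (f (i, s + 1))
  inj : ∀ p q, ChartValid L h p → ChartValid L h q → f p = f q → p = q

theorem IsQuipuPlacement.extend {V : Type*} {T : SimpleGraph V} {L : ℕ} {g : ℕ → V}
    {h : ℕ → ℕ} {f : ℕ × ℕ → V} (P : IsQuipuPlacement T L g h f)
    {i : ℕ} (h1 : 1 ≤ i) (h2 : i ≤ L) {b : V} (hb : T.Adj (f (i, h i)) b)
    (hnew : ∀ p, ChartValid L h p → f p ≠ b) :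
    IsQuipuPlacement T L g (Function.update h i (h i + 1))
      (Function.update f (i, h i + 1) b) := by
  have hv : ∀ p, ChartValid L (Function.update h i (h i + 1)) p → p ≠ (i, h i + 1) →
      ChartValid L h p := by
    rintro ⟨j, s⟩ ⟨h3, h4, h5⟩ hne
    refine ⟨h3, h4, ?_⟩
    dsimp only at h5 ⊢
    by_cases hj : j = i
    · subst hj
      rw [Function.update_self] at h5
      have : s ≠ h j + 1 := fun e => hne (by rw [e])
      omega
    · rwa [Function.update_of_ne hj] at h5
  refine ⟨fun j hj => ?_, fun j h3 h4 => ?_, fun j s hs => ?_, fun p q hp hq he => ?_⟩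
  · by_cases hji : j = i
    · subst hji; exact ⟨h1, h2⟩
    · rw [Function.update_of_ne hji] at hj
      exact P.supp j hj
  · rw [Function.update_of_ne (by simp)]
    exact P.main j h3 h4
  · by_cases hji : j = i
    · subst hji
      rw [Function.update_self] at hs
      rw [Function.update_of_ne (by simp; omega)]
      by_cases hs' : s = h j
      · subst hs'
        rwa [Function.update_self]
      · rw [Function.update_of_ne (by simpa using hs')]
        exact P.hang j s (by omega)
    · rw [Function.update_of_ne hji] at hs
      rw [Function.update_of_ne (by simp [hji]), Function.update_of_ne (by simp [hji])]
      exact P.hang j s hs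
  · by_cases e1 : p = (i, h i + 1) <;> by_cases e2 : q = (i, h i + 1)
    · rw [e1, e2]
    · rw [e1, Function.update_self, Function.update_of_ne e2] at he
      exact absurd he.symm (hnew q (hv q hq e2))
    · rw [e2, Function.update_self, Function.update_of_ne e1] at he
      exact absurd he (hnew p (hv p hp e1))
    · rw [Function.update_of_ne e1, Function.update_of_ne e2] at he
      exact P.inj p q (hv p hp e1) (hv q hq e2) he

section MainPath

variable {V : Type*} [Fintype V] {T : SimpleGraph V} [DecidableRel T.Adj] {L : ℕ} {g : ℕ → V}

theorem IsMainPath.le_card (H : IsMainPath T L g) : L ≤ Fintype.card V := by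
  have := Fintype.card_le_of_injective (fun i : Fin L => g (i + 1)) (fun i j hij => by
    have := H.inj (i + 1) (j + 1) (by omega) (by omega) (by omega) (by omega) hij
    exact Fin.ext (by omega))
  simpa using this

theorem IsOpenQuipu.exists_isMainPath (hT : IsOpenQuipu T) : ∃ L g, IsMainPath T L g := by
  obtain ⟨-, -, u, v, p, hp, hw⟩ := hT
  refine ⟨p.length + 1, fun i => p.getVert (i - 1), by omega, fun i h1 h2 => ?_,
    fun i j h1 h2 h3 h4 he => ?_, fun w hw' => ?_⟩
  · have := p.adj_getVert_succ (i := i - 1) (by omega)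
    rwa [show i - 1 + 1 = i + 1 - 1 by omega] at this
  · have := hp.getVert_injOn (show i - 1 ≤ p.length by omega) (show j - 1 ≤ p.length by omega) he
    omega
  · obtain ⟨n, hn, hn'⟩ := SimpleGraph.Walk.mem_support_iff_exists_getVert.1 (hw w hw')
    exact ⟨n + 1, by omega, by omega, hn⟩

theorem IsMainPath.append (H : IsMainPath T L g) {b : V} (hb : T.Adj (g L) b)
    (hnew : ∀ i, 1 ≤ i → i ≤ L → g i ≠ b) :
    IsMainPath T (L + 1) (fun i => if i ≤ L then g i else b) := by
  refine ⟨by omega, fun i h1 h2 => ?_, fun i j h1 h2 h3 h4 he => ?_, fun w hw => ?_⟩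
  · rw [if_pos (by omega)]
    split_ifs with h
    · exact H.adj i h1 (by omega)
    · rwa [show i = L by omega]
  · split_ifs at he with e1 e2 e2
    · exact H.inj i j h1 e1 h3 e2 he
    · exact absurd he (hnew i h1 e1)
    · exact absurd he.symm (hnew j h3 e2)
    · omega
  · obtain ⟨i, h1, h2, rfl⟩ := H.covers w hw
    exact ⟨i, h1, by omega, if_pos h2⟩

theorem IsMainPath.reverse (H : IsMainPath T L g) : IsMainPath T L (fun i => g (L + 1 - i)) := by
  refine ⟨H.pos, fun i h1 h2 => ?_, fun i j h1 h2 h3 h4 he => ?_, fun w hw => ?_⟩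
  · have := H.adj (L - i) (by omega) (by omega)
    rw [show L - i + 1 = L + 1 - i by omega] at this
    rw [show L + 1 - (i + 1) = L - i by omega]
    exact this.symm
  · have := H.inj _ _ (by omega) (by omega) (by omega) (by omega) he
    omega
  · obtain ⟨i, h1, h2, rfl⟩ := H.covers w hw
    exact ⟨L + 1 - i, by omega, by omega, by rw [show L + 1 - (L + 1 - i) = i by omega]⟩

theorem IsMainPath.mem_of_adj_last (H : IsMainPath T L g)
    (hmax : ∀ L' g', IsMainPath T L' g' → L' ≤ L) {b : V} (hb : T.Adj (g L) b) :
    ∃ i, 1 ≤ i ∧ i ≤ L ∧ g i = b := by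
  by_contra! hc
  have := hmax _ _ (H.append hb hc)
  omega

theorem IsMainPath.mem_of_adj_first (H : IsMainPath T L g)
    (hmax : ∀ L' g', IsMainPath T L' g' → L' ≤ L) {b : V} (hb : T.Adj (g 1) b) :
    ∃ i, 1 ≤ i ∧ i ≤ L ∧ g i = b := by
  obtain ⟨i, h1, h2, h3⟩ := H.reverse.mem_of_adj_last hmax (b := b)
    (by rwa [show L + 1 - L = 1 by omega])
  exact ⟨L + 1 - i, by omega, by omega, h3⟩

theorem card_le_degree [DecidableEq V] {v : V} {S : Finset V} (hS : ∀ w ∈ S, T.Adj v w) :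
    S.card ≤ T.degree v := by
  rw [← T.card_neighborFinset_eq_degree]
  exact Finset.card_le_card fun w hw => (T.mem_neighborFinset v w).2 (hS w hw)

/-- A placement all of whose hanging paths are maximal reaches every vertex. -/
theorem IsQuipuPlacement.surjective (hT : T.IsTree) (hdeg : ∀ v, T.degree v ≤ 3)
    (H : IsMainPath T L g) (hmax : ∀ L' g', IsMainPath T L' g' → L' ≤ L)
    {h : ℕ → ℕ} {f : ℕ × ℕ → V} (P : IsQuipuPlacement T L g h f)
    (hext : ∀ i b, 1 ≤ i → i ≤ L → T.Adj (f (i, h i)) b → ∃ p, ChartValid L h p ∧ f p = b)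
    (v : V) : ∃ p, ChartValid L h p ∧ f p = v := by
  classical
  by_contra hv
  obtain ⟨w⟩ := hT.connected.preconnected (f (1, 0)) v
  -- Some edge leaves the covered set. By maximality it starts neither at the end of a hanging path
  -- nor at an end of the main path. Hence it would create a vertex of degree 4 on the main path, or
  -- one of degree 3 off it.
  obtain ⟨d, -, ⟨p, hp, hpd⟩, hd2⟩ := w.exists_boundary_dart
    {v | ∃ p, ChartValid L h p ∧ f p = v} ⟨(1, 0), ⟨le_rfl, H.pos, Nat.zero_le _⟩, rfl⟩ hv
  have hadj := d.adj
  rw [← hpd] at hadj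
  generalize d.snd = b at *
  have hb : ∀ p, ChartValid L h p → f p ≠ b := fun p hp he => hd2 ⟨p, hp, he⟩
  obtain ⟨i, s⟩ := p
  obtain ⟨h1, h2, h3⟩ := id hp
  dsimp only at h1 h2 h3
  have hlt : s < h i := by
    refine lt_of_le_of_ne h3 fun e => ?_
    subst e
    exact hd2 (hext i b h1 h2 hadj)
  have hmb : ∀ i, 1 ≤ i → i ≤ L → g i ≠ b := fun j h4 h5 => by
    rw [← P.main j h4 h5]
    exact hb _ ⟨h4, h5, Nat.zero_le _⟩
  rcases s with _ | s
  · have hi1 : i ≠ 1 := by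
      rintro rfl
      rw [P.main _ h1 h2] at hadj
      obtain ⟨j, h4, h5, h6⟩ := H.mem_of_adj_first hmax hadj
      exact hmb j h4 h5 h6
    have hiL : i ≠ L := by
      rintro rfl
      rw [P.main _ h1 h2] at hadj
      obtain ⟨j, h4, h5, h6⟩ := H.mem_of_adj_last hmax hadj
      exact hmb j h4 h5 h6
    have v1 : ChartValid L h (i - 1, 0) :=
      ⟨by simp only; omega, by simp only; omega, Nat.zero_le _⟩
    have v2 : ChartValid L h (i + 1, 0) :=
      ⟨by simp only; omega, by simp only; omega, Nat.zero_le _⟩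
    have v3 : ChartValid L h (i, 1) := ⟨h1, h2, hlt⟩
    have hc := card_le_degree (T := T) (v := f (i, 0))
      (S := {b, f (i - 1, 0), f (i + 1, 0), f (i, 1)}) (by
        intro w hw
        simp only [Finset.mem_insert, Finset.mem_singleton] at hw
        rcases hw with rfl | rfl | rfl | rfl
        · exact hadj
        · rw [P.main _ h1 h2, P.main _ v1.1 v1.2.1]
          have := H.adj (i - 1) v1.1 (by omega)
          rw [Nat.sub_add_cancel h1] at this
          exact this.symm
        · rw [P.main _ h1 h2, P.main _ v2.1 v2.2.1]
          exact H.adj i h1 (by omega)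
        · exact P.hang i 0 hlt)
    have n1 : f (i - 1, 0) ≠ f (i + 1, 0) := fun e => by simpa using P.inj _ _ v1 v2 e
    have n2 : f (i - 1, 0) ≠ f (i, 1) := fun e => by simpa using P.inj _ _ v1 v3 e
    have n3 : f (i + 1, 0) ≠ f (i, 1) := fun e => by simpa using P.inj _ _ v2 v3 e
    rw [Finset.card_insert_of_notMem (by
        simp [(hb _ v1).symm, (hb _ v2).symm, (hb _ v3).symm]),
      Finset.card_insert_of_notMem (by simp [n1, n2]), Finset.card_pair n3] at hc
    have := hdeg (f (i, 0))
    omega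
  · have v1 : ChartValid L h (i, s) := ⟨h1, h2, by simp only; omega⟩
    have v2 : ChartValid L h (i, s + 2) := ⟨h1, h2, hlt⟩
    have hc := card_le_degree (T := T) (v := f (i, s + 1))
      (S := {b, f (i, s), f (i, s + 2)}) (by
        intro w hw
        simp only [Finset.mem_insert, Finset.mem_singleton] at hw
        rcases hw with rfl | rfl | rfl
        · exact hadj
        · exact (P.hang i s (by omega)).symm
        · exact P.hang i (s + 1) hlt)
    have n1 : f (i, s) ≠ f (i, s + 2) := fun e => by simpa using P.inj _ _ v1 v2 e
    rw [Finset.card_insert_of_notMem (by simp [(hb _ v1).symm, (hb _ v2).symm]),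
      Finset.card_pair n1] at hc
    obtain ⟨j, h4, h5, h6⟩ := H.covers (f (i, s + 1)) (le_antisymm (hdeg _) hc)
    rw [← P.main j h4 h5] at h6
    have := P.inj _ _ ⟨h4, h5, Nat.zero_le _⟩ hp h6
    simp at this

/-- Take a placement covering the most vertices; any hanging path that could be prolonged would
cover one more. -/
theorem exists_maximal_placement (H : IsMainPath T L g) :
    ∃ h f, IsQuipuPlacement T L g h f ∧
      ∀ i b, 1 ≤ i → i ≤ L → T.Adj (f (i, h i)) b → ∃ p, ChartValid L h p ∧ f p = b := by
  let cover : (ℕ → ℕ) → (ℕ × ℕ → V) → Set V := fun h f => f '' {p | ChartValid L h p}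
  have h0 : IsQuipuPlacement T L g (fun _ => 0) (fun p => g p.1) := by
    refine ⟨fun j hj => absurd rfl hj, fun _ _ _ => rfl, fun i s hs => by simp at hs, ?_⟩
    rintro ⟨i, s⟩ ⟨j, r⟩ ⟨h1, h2, h3⟩ ⟨h4, h5, h6⟩ he
    have := H.inj i j h1 h2 h4 h5 he
    simp only [Nat.le_zero] at h3 h6
    rw [this, h3, h6]
  obtain ⟨k, ⟨h, f, P, rfl⟩, hk⟩ := Nat.exists_greatest
    (P := fun k => ∃ h f, IsQuipuPlacement T L g h f ∧ (cover h f).ncard = k)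
    (B := Nat.card V) ⟨_, _, h0, rfl⟩ (by
      rintro k ⟨h, f, -, rfl⟩
      exact Set.ncard_le_card _)
  refine ⟨h, f, P, fun i b h1 h2 hadj => ?_⟩
  by_contra! hb
  refine absurd (hk _ ⟨_, _, P.extend h1 h2 hadj hb, rfl⟩) (not_le.2 ?_)
  refine Set.ncard_lt_ncard ⟨?_, fun hsub => ?_⟩ (Set.toFinite _)
  · rintro _ ⟨p, hp, rfl⟩
    have hne : p ≠ (i, h i + 1) := by
      rintro rfl
      exact absurd hp.2.2 (by simp)
    refine ⟨p, ⟨hp.1, hp.2.1, hp.2.2.trans ?_⟩, Function.update_of_ne hne _ _⟩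
    by_cases hpi : p.1 = i
    · rw [hpi, Function.update_self]
      omega
    · rw [Function.update_of_ne hpi]
  · obtain ⟨p, hp, he⟩ := hsub ⟨(i, h i + 1), ⟨h1, h2, by simp⟩, Function.update_self _ _ _⟩
    exact hb p hp he

/-- The edges prescribed by the coordinates form a connected spanning subgraph `G` of `T`. A tree is
minimally connected, so `G` is all of `T`. -/
theorem IsQuipuPlacement.nonempty_chart (hT : T.IsTree) (H : IsMainPath T L g) {h : ℕ → ℕ}
    {f : ℕ × ℕ → V} (P : IsQuipuPlacement T L g h f)
    (hsurj : ∀ v, ∃ p, ChartValid L h p ∧ f p = v) : Nonempty (QuipuChart T L h) := by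
  choose coord hvalid hf using hsurj
  have hcf : ∀ p, ChartValid L h p → coord (f p) = p :=
    fun p hp => P.inj _ _ (hvalid _) hp (hf _)
  let G : SimpleGraph V :=
    { Adj := fun v w => coord w ∈ chartNbrs (coord v)
      symm := ⟨fun v w hvw => mem_chartNbrs_symm (hvalid v).1 (hvalid w).1 hvw⟩
      loopless := ⟨fun v hv => by
        have := (hvalid v).1
        generalize coord v = p at *
        obtain ⟨i, _ | s⟩ := p
        · simp only [chartNbrs, Finset.mem_insert, Finset.mem_singleton, Prod.mk.injEq] at hv
          dsimp only at this
          omega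
        · simp [chartNbrs] at hv⟩ }
  let C : QuipuChart G L h := ⟨f, coord, P.supp, hvalid, hf, hcf, fun _ _ => Iff.rfl⟩
  have hle : G ≤ T := by
    have hmain : ∀ i, 1 ≤ i → i + 1 ≤ L → T.Adj (f (i, 0)) (f (i + 1, 0)) := fun i h1 h2 => by
      rw [P.main i h1 (by omega), P.main (i + 1) (by omega) h2]
      exact H.adj i h1 h2
    intro v w hvw
    replace hvw : coord w ∈ chartNbrs (coord v) := hvw
    obtain ⟨h1, h2, h3⟩ := hvalid v
    obtain ⟨h4, h5, h6⟩ := hvalid w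
    rw [← hf v, ← hf w]
    generalize coord v = p at *
    generalize coord w = q at *
    obtain ⟨i, s⟩ := p
    obtain ⟨j, r⟩ := q
    dsimp only at h1 h2 h3 h4 h5 h6
    rcases s with _ | s <;>
      simp only [chartNbrs, Finset.mem_insert, Finset.mem_singleton, Prod.mk.injEq] at hvw
    · rcases hvw with ⟨rfl, rfl⟩ | ⟨rfl, rfl⟩ | ⟨rfl, rfl⟩
      · have := hmain (i - 1) h4 (by omega)
        rw [Nat.sub_add_cancel h1] at this
        exact this.symm
      · exact hmain i h1 h5
      · exact P.hang _ 0 h6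
    · rcases hvw with ⟨rfl, rfl⟩ | ⟨rfl, rfl⟩
      · exact (P.hang _ _ h3).symm
      · exact P.hang _ _ h6
  have hge := (SimpleGraph.isTree_iff_minimal_connected.1 hT).2 C.connected hle
  refine ⟨⟨f, coord, P.supp, hvalid, hf, hcf, fun v w => ⟨fun hvw => hge hvw, fun hvw => ?_⟩⟩⟩
  exact hle (show G.Adj v w from hvw)

theorem QuipuChart.coord_of_degree_eq_three {h : ℕ → ℕ} (C : QuipuChart T L h) {w : V}
    (hw : T.degree w = 3) : (C.coord w).2 = 0 ∧ h (C.coord w).1 ≠ 0 := by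
  classical
  have h0 : (C.coord w).2 = 0 := by
    have hd := C.degree_le w
    rw [hw] at hd
    generalize C.coord w = q at *
    obtain ⟨i, _ | s⟩ := q
    · rfl
    · exact absurd (hd.trans Finset.card_le_two) (by norm_num)
  refine ⟨h0, fun hz => ?_⟩
  have hsub : (T.neighborFinset w).image C.coord ⊆
      {((C.coord w).1 - 1, 0), ((C.coord w).1 + 1, 0)} := by
    intro q hq
    obtain ⟨v, hv, rfl⟩ := Finset.mem_image.1 hq
    have hadj := (C.adj_iff w v).1 ((T.mem_neighborFinset w v).1 hv)
    have hval := C.valid v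
    generalize C.coord v = q at *
    generalize C.coord w = p at *
    obtain ⟨i, s⟩ := p
    dsimp only at h0 hz
    subst h0
    rw [chartNbrs] at hadj
    simp only [Finset.mem_insert, Finset.mem_singleton] at hadj ⊢
    rcases hadj with rfl | rfl | rfl
    · exact Or.inl rfl
    · exact Or.inr rfl
    · exact absurd hval.2.2 (by simp [hz])
  have := (Finset.card_le_card hsub).trans Finset.card_le_two
  rw [Finset.card_image_of_injective _ C.coord_injective, T.card_neighborFinset_eq_degree, hw]
    at this
  omega

/-- Replacing the end of the main path before `a` by the path hanging at `a` loses no vertex of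
degree 3, so the new path cannot be longer. -/
theorem QuipuChart.first_le {h : ℕ → ℕ} (C : QuipuChart T L h)
    (hmax : ∀ L' g', IsMainPath T L' g' → L' ≤ L) {a : ℕ} (ha : h a ≠ 0)
    (hz : ∀ i, i < a → h i = 0) : h a + 1 ≤ a := by
  have hL := C.supp a ha
  -- Down the hanging path from its tip, then along the main path from `a`.
  let e : ℕ → ℕ × ℕ := fun j => if j ≤ h a then (a, h a + 1 - j) else (a + (j - h a - 1), 0)
  have he : ∀ j, 1 ≤ j → j ≤ L - a + 1 + h a → ChartValid L h (e j) := by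
    intro j h1 h2
    simp only [e]
    split_ifs with h3
    · exact ⟨hL.1, hL.2, by simp only; omega⟩
    · exact ⟨by simp only; omega, by simp only; omega, Nat.zero_le _⟩
  have hpath : IsMainPath T (L - a + 1 + h a) (fun j => C.f (e j)) := by
    refine ⟨by omega, fun i h1 h2 => ?_, fun i j h1 h2 h3 h4 hij => ?_, fun w hw => ?_⟩
    · rcases Nat.lt_trichotomy i (h a) with h3 | h3 | h3
      · simp only [e]
        rw [if_pos h3.le, if_pos (by omega)]
        have := C.adj_hang (i := a) (s := h a + 1 - (i + 1)) (by omega)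
        rw [show h a + 1 - (i + 1) + 1 = h a + 1 - i by omega] at this
        exact this.symm
      · simp only [e]
        rw [if_pos h3.le, if_neg (by omega), h3]
        have := C.adj_hang (i := a) (s := 0) (by omega)
        rw [show a + (h a + 1 - h a - 1) = a by omega, show h a + 1 - h a = 0 + 1 by omega]
        exact this.symm
      · simp only [e]
        rw [if_neg (by omega), if_neg (by omega)]
        have := C.adj_main (i := a + (i - h a - 1)) (by omega) (by omega)
        rwa [show a + (i - h a - 1) + 1 = a + (i + 1 - h a - 1) by omega] at this
    · have h5 := congrArg C.coord hij
      rw [C.coord_f _ (he i h1 h2), C.coord_f _ (he j h3 h4)] at h5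
      simp only [e] at h5
      split_ifs at h5 <;> rw [Prod.mk.injEq] at h5 <;> omega
    · obtain ⟨h1, h2⟩ := C.coord_of_degree_eq_three hw
      obtain ⟨h3, h4, -⟩ := C.valid w
      have h5 : a ≤ (C.coord w).1 := by
        by_contra hc
        exact h2 (hz _ (by omega))
      refine ⟨(C.coord w).1 - a + h a + 1, by omega, by omega, ?_⟩
      simp only [e]
      rw [if_neg (by omega), show a + ((C.coord w).1 - a + h a + 1 - h a - 1) = (C.coord w).1 by
        omega, ← h1, Prod.mk.eta, C.f_coord]
  have := hmax _ _ hpath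
  omega

/-- An open quipu, traversed along a longest path through its vertices of degree `3`. -/
theorem IsOpenQuipu.exists_chart (hT : IsOpenQuipu T) :
    ∃ L h, 1 ≤ L ∧ Nonempty (QuipuChart T L h) ∧
      (∀ a, h a ≠ 0 → (∀ i, i < a → h i = 0) → h a + 1 ≤ a) ∧
      (∀ b, h b ≠ 0 → (∀ i, b < i → h i = 0) → h b + b ≤ L) := by
  obtain ⟨L₀, g₀, H₀⟩ := hT.exists_isMainPath
  obtain ⟨L, ⟨g, H⟩, hmax'⟩ := Nat.exists_greatest (P := fun L => ∃ g, IsMainPath T L g)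
    ⟨g₀, H₀⟩ (fun k ⟨g, hk⟩ => hk.le_card)
  have hmax : ∀ L' g', IsMainPath T L' g' → L' ≤ L := fun L' g' h => hmax' L' ⟨g', h⟩
  obtain ⟨h, f, P, hext⟩ := exists_maximal_placement H
  obtain ⟨C⟩ := P.nonempty_chart hT.1 H (P.surjective hT.1 hT.2.1 H hmax hext)
  refine ⟨L, h, H.pos, ⟨C⟩, fun a ha hz => C.first_le hmax ha hz, fun b hb hz => ?_⟩
  have hL := C.supp b hb
  have := C.reverse.first_le hmax (a := L + 1 - b)
    (by simpa [show L + 1 - (L + 1 - b) = b by omega] using hb)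
    (fun i hi => hz _ (by omega))
  simp only [show L + 1 - (L + 1 - b) = b by omega] at this
  omega

end MainPath

/-! ### Isomorphisms and the chart of `openQuipu` -/

namespace QuipuChart

variable {V W : Type*} {T : SimpleGraph V} {Q : SimpleGraph W} {L : ℕ} {h : ℕ → ℕ}

/-- Graphs with identifications of the same shape are isomorphic. -/
def iso (C : QuipuChart T L h) (D : QuipuChart Q L h) : T ≃g Q where
  toFun v := D.f (C.coord v)
  invFun w := C.f (D.coord w)
  left_inv v := by simp only [D.coord_f _ (C.valid v), C.f_coord]
  right_inv w := by simp only [C.coord_f _ (D.valid w), D.f_coord]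
  map_rel_iff' := by
    intro v w
    simp only [Equiv.coe_fn_mk, D.adj_f (C.valid v) (C.valid w), C.adj_iff]

/-- Transport of an identification along an isomorphism. -/
def ofIso (D : QuipuChart Q L h) (e : T ≃g Q) : QuipuChart T L h where
  f p := e.symm (D.f p)
  coord v := D.coord (e v)
  supp := D.supp
  valid v := D.valid _
  f_coord v := by simp [D.f_coord]
  coord_f p hp := by simp [D.coord_f p hp]
  adj_iff v w := by rw [← D.adj_iff, e.map_adj_iff]

theorem nonempty_of_coord [Nonempty V] (hsupp : ∀ j, h j ≠ 0 → 1 ≤ j ∧ j ≤ L) (coord : V → ℕ × ℕ)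
    (hinj : Function.Injective coord) (hvalid : ∀ v, ChartValid L h (coord v))
    (hsurj : ∀ p, ChartValid L h p → ∃ v, coord v = p)
    (hadj : ∀ v w, T.Adj v w ↔ coord w ∈ chartNbrs (coord v)) :
    Nonempty (QuipuChart T L h) :=
  ⟨⟨Function.invFun coord, coord, hsupp, hvalid, Function.leftInverse_invFun hinj,
    fun p hp => Function.invFun_eq (hsurj p hp), hadj⟩⟩

end QuipuChart

/-- Position of a vertex of a quipu: its place on the main path, counted from `1`, and its distance
to the main path. -/
def quipuCoord {r : ℕ} (k : Fin (r + 2) → ℕ) (m : Fin (r + 1) → ℕ) : QuipuVertex k m → ℕ × ℕ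
  | Sum.inl a => (a.val + 1, 0)
  | Sum.inr ⟨i, s⟩ => (quipuBranchPos k i + 1, s.val + 1)

theorem quipuCoord_injective {r : ℕ} {k : Fin (r + 2) → ℕ} {m : Fin (r + 1) → ℕ}
    (hk : Function.Injective (quipuBranchPos k)) : Function.Injective (quipuCoord k m) := by
  rintro (a | ⟨i, s⟩) (b | ⟨j, t⟩) he <;>
    simp only [quipuCoord, Prod.mk.injEq, Nat.add_right_cancel_iff] at he
  · rw [Fin.ext he.1]
  · omega
  · omega
  · obtain rfl := hk he.1
    rw [Fin.ext he.2]

theorem openQuipu_adj_iff {r : ℕ} {k : Fin (r + 2) → ℕ} {m : Fin (r + 1) → ℕ}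
    (hk : Function.Injective (quipuBranchPos k)) (v w : QuipuVertex k m) :
    (openQuipu k m).Adj v w ↔ quipuCoord k m w ∈ chartNbrs (quipuCoord k m v) := by
  have hne : ∀ (P : Prop), (P → v ≠ w) → ((v ≠ w ∧ P) ↔ P) :=
    fun P hP => ⟨fun h => h.2, fun h => ⟨hP h, h⟩⟩
  rw [openQuipu, SimpleGraph.fromRel_adj]
  rcases v with a | ⟨i, s⟩ <;> rcases w with b | ⟨j, t⟩ <;>
    simp only [quipuCoord, quipuRel, chartNbrs, Finset.mem_insert, Finset.mem_singleton,
      Prod.mk.injEq, and_true]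
  · rw [hne]
    · omega
    · rintro h e
      rw [Sum.inl.injEq] at e
      subst e
      omega
  · simp only [ne_eq, reduceCtorEq, not_false_eq_true, true_and, or_false, and_false, false_or]
    omega
  · simp only [ne_eq, reduceCtorEq, not_false_eq_true, true_and, false_or, and_false, or_false]
    omega
  · rw [hne]
    · constructor
      · rintro (⟨rfl, h⟩ | ⟨rfl, h⟩)
        · exact Or.inr ⟨rfl, by omega⟩
        · exact Or.inl ⟨rfl, by omega⟩
      · rintro (⟨h1, h2⟩ | ⟨h1, h2⟩)
        · exact Or.inr ⟨hk (by omega), by omega⟩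
        · exact Or.inl ⟨(hk (by omega)).symm, by omega⟩
    · rintro h e
      cases e
      omega

section Extremal

variable {m : ℕ}

theorem quipuBranchPos_extremal_zero (m : ℕ) : quipuBranchPos (r := 1) ![1, m - 2, m] 0 = 1 := by
  simp [quipuBranchPos]

theorem quipuBranchPos_extremal_one (hm : 2 ≤ m) :
    quipuBranchPos (r := 1) ![1, m - 2, m] 1 = m := by
  simp [quipuBranchPos, Fin.sum_univ_three]
  omega

theorem quipuBranchPos_extremal_injective (hm : 2 ≤ m) :
    Function.Injective (quipuBranchPos (r := 1) ![1, m - 2, m]) := by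
  intro i j hij
  have h0 := quipuBranchPos_extremal_zero m
  have h1 := quipuBranchPos_extremal_one hm
  fin_cases i <;> fin_cases j <;> first | rfl | (simp at hij h0 h1; omega)

theorem sum_extremal_blocks (hm : 2 ≤ m) :
    (∑ j : Fin (1 + 2), (![1, m - 2, m] : Fin (1 + 2) → ℕ) j) + (1 + 1) = 2 * m + 1 := by
  simp [Fin.sum_univ_three]
  omega

theorem nonempty_chart_extremal (hm : 2 ≤ m) :
    Nonempty (QuipuChart (openQuipu (r := 1) ![1, m - 2, m] ![1, m]) (2 * m + 1)
      (extremalHang m)) := by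
  have hsum := sum_extremal_blocks hm
  have h0 := quipuBranchPos_extremal_zero m
  have h1 := quipuBranchPos_extremal_one hm
  have hinj := quipuBranchPos_extremal_injective hm
  have : Nonempty (QuipuVertex (r := 1) ![1, m - 2, m] ![1, m]) :=
    ⟨Sum.inl ⟨0, by omega⟩⟩
  refine QuipuChart.nonempty_of_coord (extremalHang_supp hm) (quipuCoord _ _)
    (quipuCoord_injective hinj) ?_ ?_ (openQuipu_adj_iff hinj)
  · rintro (a | ⟨i, s⟩)
    · have := a.isLt
      exact ⟨Nat.le_add_left 1 _, by simp only [quipuCoord]; omega, Nat.zero_le _⟩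
    · have hi : i = 0 ∨ i = 1 := by fin_cases i <;> simp
      rcases hi with rfl | rfl
      · have hs : s.val < 1 := s.isLt
        rw [quipuCoord, h0]
        exact ⟨by simp, by simp only; omega, by
          change s.val + 1 ≤ extremalHang m 2
          rw [extremalHang_two]
          omega⟩
      · have hs : s.val < m := s.isLt
        rw [quipuCoord, h1]
        exact ⟨by simp, by simp only; omega, by simp only [extremalHang_add_one hm]; omega⟩
  · rintro ⟨i, s⟩ ⟨h2, h3, h4⟩
    dsimp only at h2 h3 h4
    rcases s with _ | s
    · exact ⟨Sum.inl ⟨i - 1, by omega⟩, by simp only [quipuCoord, Nat.sub_add_cancel h2]⟩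
    · unfold extremalHang at h4
      split_ifs at h4 with h5 h6
      · refine ⟨Sum.inr ⟨0, ⟨s, h4⟩⟩, ?_⟩
        simp only [quipuCoord, h0, h5]
      · refine ⟨Sum.inr ⟨1, ⟨s, h4⟩⟩, ?_⟩
        simp only [quipuCoord, h1, h6]
      · omega

end Extremal

/-! ### Conclusion -/

theorem IsOpenQuipu.diam_bound {V : Type*} [Fintype V] [DecidableEq V] {T : SimpleGraph V}
    [DecidableRel T.Adj] (hT : IsOpenQuipu T)
    (hρ : graphSpectralRadius T < 3 / 2 * Real.sqrt 2) :
    2 * Fintype.card V ≤ 3 * T.diam + 4 ∧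
      (2 * Fintype.card V = 3 * T.diam + 4 →
        ∃ m, 2 ≤ m ∧ Nonempty (QuipuChart T (2 * m + 1) (extremalHang m))) := by
  obtain ⟨L, h, hL, ⟨C⟩, hfirst, hlast⟩ := hT.exists_chart
  obtain ⟨Z, P⟩ := C.exists_profile hρ hfirst hlast
  obtain ⟨h1, h2⟩ := P.two_mul_sum_le hL
  have hd := C.le_diam_of_isTree hT.1 hL
  have hc := C.card_eq
  -- `2n = 2L + 2S ≤ 3L + 1 ≤ 3 * diam + 4`; equality forces `2S = L + 1`.
  refine ⟨by omega, fun he => ?_⟩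
  obtain ⟨m, hm, rfl, rfl | h3⟩ := h2 (by omega)
  · exact ⟨m, hm, ⟨C⟩⟩
  · exact ⟨m, hm, ⟨h3 ▸ C.reverse⟩⟩

theorem theorem1 {V : Type*} [Fintype V] [DecidableEq V]
    (T : SimpleGraph V) [DecidableRel T.Adj] (hn : 6 ≤ Fintype.card V) :
    (IsOpenQuipu T → graphSpectralRadius T < 3 / 2 * Real.sqrt 2 →
      (2 * (Fintype.card V : ℝ) - 4) / 3 ≤ (T.diam : ℝ)) ∧
    ((IsOpenQuipu T ∧ graphSpectralRadius T < 3 / 2 * Real.sqrt 2 ∧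
        (T.diam : ℝ) = (2 * (Fintype.card V : ℝ) - 4) / 3) ↔
      ∃ m : ℕ, 2 ≤ m ∧ Nonempty (T ≃g openQuipu (r := 1) ![1, m - 2, m] ![1, m])) := by
  refine ⟨fun hT hρ => ?_, fun ⟨hT, hρ, hd⟩ => ?_, fun ⟨m, hm, ⟨e⟩⟩ => ?_⟩
  · have h1 : (2 * Fintype.card V : ℝ) ≤ 3 * T.diam + 4 := by
      exact_mod_cast (hT.diam_bound hρ).1
    linarith
  · have h1 : (2 * Fintype.card V : ℝ) = 3 * T.diam + 4 := by linarith
    obtain ⟨m, hm, ⟨C⟩⟩ := (hT.diam_bound hρ).2 (by exact_mod_cast h1)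
    obtain ⟨D⟩ := nonempty_chart_extremal hm
    exact ⟨m, hm, ⟨C.iso D⟩⟩
  · obtain ⟨D⟩ := nonempty_chart_extremal hm
    have C := D.ofIso e
    refine ⟨C.isOpenQuipu (by omega), C.graphSpectralRadius_lt hm, ?_⟩
    rw [C.diam_eq hm, C.card_eq_of_extremal hm]
    push_cast
    ring
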